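/- Let $(A,\mathfrak m)$ be a Noetherian local ring with infinite residue field and let $J$ be an $\mathfrak m$-primary ideal of $A$. A filtration $\mathcal F=\{I_n\}_{n\ge 0}$ is a chain of ideals $A=I_0\supseteq I_1\supseteq I_2\supseteq\cdots$ with $I_1\neq A$ and $I_mI_n\subseteq I_{m+n}$ for all $m,n$. An ideal $\mathfrak I$ is a reduction of $\mathcal F$ if $\mathfrak I I_n\subseteq I_{n+1}$ for all $n\ge 0$, with equality for all large $n$. The filtration $\mathcal F$ is good if it has a reduction, and nilpotent if $I_n=0$ for all large $n$. If $\mathfrak I$ is a reduction of $\mathcal F$, let $r_{\mathfrak I}(\mathcal F)$ be the least $n$ such that $\mathfrak I I_m=I_{m+1}$ for all $m\ge n$. For an ideal $Q$ of $A$ put $\mathcal F/Q=\{I_n(A/Q)\}_{n\ge 0}$. Let $F_J(\mathcal F)=\bigoplus_{n\ge 0}(I_n/JI_n)t^n$ be the fiber cone, and put $F_J(\mathcal F/Q)=F_{J(A/Q)}(\mathcal F/Q)=\bigoplus_{n\ge 0}\big[(I_n+Q)/(JI_n+Q)\big]t^n$. The multiplicity $e(F_J(\cdot))$ is the Hilbert–Samuel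 multiplicity of the localization of the fiber cone at its maximal homogeneous ideal (the image of the maximal homogeneous ideal of the Rees algebra). The analytic spread is $\ell(\mathcal F)=\dim F_{\mathfrak m}(\mathcal F)$. For ideals $Q,I$ write $Q:I^\infty=\bigcup_k (Q:I^k)$. For a ring $B$, an ideal $I$ of $B$ and a non-nilpotent good filtration $\mathcal G=\{G_n\}_{n\ge0}$ of ideals of $B$, an element $x\in G_1$ is a weak-(FC)-element with respect to $(I,\mathcal G)$ if (FC$_1$) for all large $n$ and all $m\ge 0$, $I^mG_n\cap (x)=I^m x\,G_{n-1}$, and (FC$_2$) $0:x\subseteq 0:G_1^\infty$. A sequence $x_1,\dots,x_s$ in $I_1$ is a weak-(FC)-sequence with respect to $(J,\mathcal F)$ if, for each $0\le i<s$, with $A_i=A/(x_1,\dots,x_i)$, the filtration $\mathcal F/(x_1,\dots,x_i)$ is good and non-nilpotent and the image of $x_{i+1}$ in $A_i$ is a weak-(FC)-element with respect to $(JA_i,\mathcal F/(x_1,\dots,x_i))$. **Proposition 3.1.** Let $\mathcal F=\{I_n\}_{n\ge 0}$ be a good filtration of ideals of $A$ with $\ell(\mathcal F)=\ell>0$, and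 let $x_1,\dots,x_\ell$ be a weak-(FC)-sequence in $I_1$ with respect to $(J,\mathcal F)$. Set $\mathfrak I=(x_1,\dots,x_\ell)$ and $I_{-1}=0$. For $0\le i<\ell$ set $P(i)=(x_1,\dots,x_i):I_1^\infty$, $\mathcal F(i)=\mathcal F/(x_1,\dots,x_i)$ and $\mathcal F'(i)=\mathcal F/P(i)$. Then $\mathfrak I$ is a reduction of $\mathcal F$, and for every $0\le i<\ell$: (i) $e(F_J(\mathcal F))=e(F_J(\mathcal F(i)))=e(F_J(\mathcal F'(i)))$; (ii) $l_A\!\left[\dfrac{F_J(\mathcal F'(i))}{\mathfrak I tF_J(\mathcal F'(i))}\right]\le l_A\!\left[\dfrac{F_J(\mathcal F(i))}{\mathfrak I tF_J(\mathcal F(i))}\right]\le l_A\!\left[\dfrac{F_J(\mathcal F)}{\mathfrak I tF_J(\mathcal F)}\right]<\infty$; (iii) $l_A\!\left[\dfrac{F_J(\mathcal F'(i))}{\mathfrak I tF_J(\mathcal F'(i))}\right]= l_A\!\left[\dfrac{F_J(\mathcal F)}{\mathfrak I tF_J(\mathcal F)}\right]$ if and only if $I_n\cap P(i)\subseteq \mathfrak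 I I_{n-1}+JI_n$ for all $0\le n\le r_{\mathfrak I}(\mathcal F)$. -/

import Mathlib

open Polynomial Filter Topology

universe u v

/-- A filtration of ideals `A = I₀ ⊇ I₁ ⊇ I₂ ⊇ …` with `Iₘ Iₙ ⊆ Iₘ₊ₙ`.
(The requirement that `I₁` is proper is part of `IdealFiltration.IsGood` below.) -/
structure IdealFiltration (A : Type u) [CommRing A] where
  /-- the `n`-th ideal of the filtration -/
  ideal : ℕ → Ideal A
  ideal_zero : ideal 0 = ⊤
  ideal_succ_le : ∀ n, ideal (n + 1) ≤ ideal n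
  mul_le : ∀ m n, ideal m * ideal n ≤ ideal (m + n)

/-- The saturation `Q : I^∞ = ⋃ₖ (Q : I^k)`. -/
def idealSaturation {A : Type u} [CommRing A] (Q I : Ideal A) : Ideal A where
  carrier := {a | ∃ k : ℕ, ∀ b ∈ I ^ k, a * b ∈ Q}
  add_mem' := by
    rintro a a' ⟨k, hk⟩ ⟨k', hk'⟩
    refine ⟨k + k', fun b hb => ?_⟩
    rw [add_mul]
    exact Q.add_mem (hk b (Ideal.pow_le_pow_right (Nat.le_add_right k k') hb))
      (hk' b (Ideal.pow_le_pow_right (Nat.le_add_left k' k) hb))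
  zero_mem' := ⟨0, fun b _ => by simp⟩
  smul_mem' := by
    rintro c a ⟨k, hk⟩
    refine ⟨k, fun b hb => ?_⟩
    rw [smul_eq_mul, mul_assoc]
    exact Q.mul_mem_left c (hk b hb)

namespace IdealFiltration

section Basic

variable {A : Type u} [CommRing A] (F : IdealFiltration A)

/-- The ideal `Iₙ₋₁`, with the convention `I₋₁ = 0`. -/
def prevIdeal : ℕ → Ideal A
  | 0 => ⊥
  | n + 1 => F.ideal n

/-- `F` is an `I`-good filtration: `I Iₙ ⊆ Iₙ₊₁` for all `n`, with equality for all large `n`.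
One also says that `I` is a reduction of `F`. -/
def IsReduction (I : Ideal A) : Prop :=
  (∀ n, I * F.ideal n ≤ F.ideal (n + 1)) ∧
    ∃ N, ∀ n, N ≤ n → F.ideal (n + 1) = I * F.ideal n

/-- A good filtration: `I₁` is a proper ideal and `F` is `I`-good for some ideal `I`. -/
def IsGood : Prop :=
  F.ideal 1 ≠ ⊤ ∧ ∃ I : Ideal A, F.IsReduction I

/-- A nilpotent filtration: `Iₙ = 0` for all large `n`. -/
def IsNilpotent : Prop :=
  ∃ N, ∀ n, N ≤ n → F.ideal n = ⊥

/-- The reduction number of `F` with respect to a reduction `I`: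
the least `n` with `I Iₘ = Iₘ₊₁` for all `m ≥ n`. -/
noncomputable def reductionNumber (I : Ideal A) : ℕ :=
  sInf {n | ∀ m, n ≤ m → I * F.ideal m = F.ideal (m + 1)}

/-- The filtration `F/Q = {Iₙ (A/Q)}` of the ring `A/Q`. -/
def quotient (Q : Ideal A) : IdealFiltration (A ⧸ Q) where
  ideal n := (F.ideal n).map (Ideal.Quotient.mk Q)
  ideal_zero := by rw [F.ideal_zero, Ideal.map_top]
  ideal_succ_le n := Ideal.map_mono (F.ideal_succ_le n)
  mul_le m n := by
    rw [← Ideal.map_mul]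
    exact Ideal.map_mono (F.mul_le m n)

/-- `x` is a weak-(FC)-element with respect to `(I, F)`. -/
structure IsWeakFCElement (I : Ideal A) (x : A) : Prop where
  good : F.IsGood
  not_nilpotent : ¬ F.IsNilpotent
  mem : x ∈ F.ideal 1
  /-- (FC₁): `I^m Iₙ ∩ (x) = I^m x Iₙ₋₁` for all large `n` and all `m ≥ 0`. -/
  fc1 : ∃ N, ∀ n, N ≤ n → ∀ m : ℕ,
    I ^ m * F.ideal (n + 1) ⊓ Ideal.span {x} = I ^ m * (Ideal.span {x} * F.ideal n)
  /-- (FC₂): `0 : x ⊆ 0 : I₁^∞`. -/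
  fc2 : ∀ a : A, a * x = 0 → a ∈ idealSaturation ⊥ (F.ideal 1)

end Basic

end IdealFiltration

/-- For a sequence `x₁, …, xₛ` (indexed here by `Fin s`), the ideal `(x₁, …, xᵢ)`
generated by its first `i` members. -/
def initialIdeal {A : Type u} [CommRing A] {s : ℕ} (x : Fin s → A) (i : ℕ) : Ideal A :=
  Ideal.span {a | ∃ j : Fin s, (j : ℕ) < i ∧ x j = a}

namespace IdealFiltration

section Cone

variable {A : Type u} [CommRing A] (F : IdealFiltration A)

/-- `x₁, …, xₛ` is a weak-(FC)-sequence in `I₁` with respect to `(I, F)`: for each `0 ≤ i < s` the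
image of `xᵢ₊₁` in `Aᵢ = A/(x₁, …, xᵢ)` is a weak-(FC)-element with respect to
`(I Aᵢ, F/(x₁, …, xᵢ))`. -/
def IsWeakFCSequence (I : Ideal A) {s : ℕ} (x : Fin s → A) : Prop :=
  (∀ i, x i ∈ F.ideal 1) ∧
    ∀ i : Fin s, (F.quotient (initialIdeal x i)).IsWeakFCElement
      (I.map (Ideal.Quotient.mk (initialIdeal x i)))
      (Ideal.Quotient.mk (initialIdeal x i) (x i))

/-- The Rees algebra `R(F) = ⨁ₙ Iₙ tⁿ`, as a subalgebra of the polynomial ring `A[t]`. -/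
def rees : Subalgebra A A[X] where
  carrier := {f | ∀ n, f.coeff n ∈ F.ideal n}
  mul_mem' := by
    intro f g hf hg n
    rw [coeff_mul]
    refine Ideal.sum_mem _ ?_
    rintro ⟨j, k⟩ e
    rw [← Finset.HasAntidiagonal.mem_antidiagonal.mp e]
    exact F.mul_le j k (Ideal.mul_mem_mul (hf j) (hg k))
  add_mem' := by
    intro f g hf hg n
    rw [coeff_add]
    exact Ideal.add_mem _ (hf n) (hg n)
  algebraMap_mem' := by
    intro r n
    rw [Polynomial.algebraMap_apply, coeff_C]
    split_ifs with h
    · subst h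
      simp [F.ideal_zero]
    · simp

/-- The ideal `⨁ₙ J Iₙ tⁿ` of the Rees algebra. -/
def fiberIdeal (J : Ideal A) : Ideal F.rees where
  carrier := {f | ∀ n, (f : A[X]).coeff n ∈ J * F.ideal n}
  add_mem' := by
    intro f g hf hg n
    simpa using Ideal.add_mem _ (hf n) (hg n)
  zero_mem' := by
    intro n
    simp
  smul_mem' := by
    intro c f hf n
    rw [smul_eq_mul, Subalgebra.coe_mul, coeff_mul]
    refine Ideal.sum_mem _ ?_
    rintro ⟨j, k⟩ e
    rw [← Finset.HasAntidiagonal.mem_antidiagonal.mp e]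
    have h1 := Ideal.mul_mem_mul (c.2 j) (hf k)
    have h2 : F.ideal j * (J * F.ideal k) = J * (F.ideal j * F.ideal k) := by
      rw [← mul_assoc, mul_comm (F.ideal j) J, mul_assoc]
    rw [h2] at h1
    exact Ideal.mul_mono_right (F.mul_le j k) h1

/-- The fiber cone `F_J(F) = ⨁ₙ (Iₙ / J Iₙ) tⁿ`, as the quotient ring of the Rees algebra
`⨁ₙ Iₙ tⁿ` by the ideal `⨁ₙ J Iₙ tⁿ`. -/
def FiberCone (J : Ideal A) : Type u := F.rees ⧸ F.fiberIdeal J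

noncomputable instance (J : Ideal A) : CommRing (F.FiberCone J) :=
  inferInstanceAs (CommRing (F.rees ⧸ F.fiberIdeal J))

noncomputable instance (B : Type v) [CommRing B] [Algebra B A] (J : Ideal A) :
    Algebra B (F.FiberCone J) :=
  inferInstanceAs (Algebra B (F.rees ⧸ F.fiberIdeal J))

/-- The projection of the Rees algebra onto the fiber cone. -/
noncomputable def toFiberCone (J : Ideal A) : F.rees →+* F.FiberCone J :=
  Ideal.Quotient.mk (F.fiberIdeal J)

/-- The ideal `𝔞 t F_J(F)` of the fiber cone, generated by the classes of the elements `a t`,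
`a ∈ 𝔞` (for an ideal `𝔞 ⊆ I₁`). -/
noncomputable def degreeOneIdeal (J 𝔞 : Ideal A) : Ideal (F.FiberCone J) :=
  Ideal.span {z | ∃ f : F.rees, (∃ a ∈ 𝔞, (f : A[X]) = monomial 1 a) ∧
    F.toFiberCone J f = z}

/-- The elements of the Rees algebra whose constant coefficient is a unit of `A`. When `A` is a
local ring with maximal ideal `𝔪`, this is the complement of the maximal homogeneous ideal
`𝔐 = 𝔪 ⊕ ⨁ₙ≥₁ Iₙ tⁿ`. -/
noncomputable def maxHomogeneousCompl : Submonoid F.rees where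
  carrier := {f | IsUnit ((f : A[X]).coeff 0)}
  mul_mem' := by
    intro f g hf hg
    simpa [mul_coeff_zero] using And.intro hf hg
  one_mem' := by simp

/-- The localization `F_J(F)_𝔐` of the fiber cone at the maximal homogeneous ideal `𝔐` of the
Rees algebra (for `A` local). -/
abbrev LocalFiberCone (J : Ideal A) : Type u :=
  Localization (F.maxHomogeneousCompl.map (F.toFiberCone J))

/-- The analytic spread `ℓ(F) = dim F_𝔪(F)` of a filtration of a local ring. -/
noncomputable def analyticSpread [IsLocalRing A] : WithBot ℕ∞ :=
  ringKrullDim (F.FiberCone (IsLocalRing.maximalIdeal A))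

/-- The length `l_B(F_J(F) / 𝔞 t F_J(F))` over a ring `B` of which `A` is an algebra. -/
noncomputable def fiberColength (B : Type v) [CommRing B] [Algebra B A] (J 𝔞 : Ideal A) : ℕ∞ :=
  Module.length B (F.FiberCone J ⧸ F.degreeOneIdeal J 𝔞)

end Cone

end IdealFiltration

/-- `R` is a Noetherian local ring whose Hilbert–Samuel multiplicity is `e`, that is,
`e = lim d! l(R/𝔪ⁿ) / n^d` with `d = dim R`. -/
def HasHilbertSamuelMultiplicity (R : Type u) [CommRing R] (e : ℝ) : Prop :=
  IsNoetherianRing R ∧ ∃ _ : IsLocalRing R, ∃ d : ℕ, ringKrullDim R = d ∧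
    Tendsto (fun n : ℕ => (Nat.factorial d : ℝ) *
      ((Module.length R (R ⧸ IsLocalRing.maximalIdeal R ^ n)).toNat : ℝ) / (n : ℝ) ^ d)
      atTop (𝓝 e)

/-- `e` is the multiplicity of the fiber cone `F_J(F)`, that is, the Hilbert–Samuel multiplicity
of the local ring `F_J(F)_𝔐`. -/
def IdealFiltration.HasFiberMultiplicity {A : Type u} [CommRing A] (F : IdealFiltration A)
    (J : Ideal A) (e : ℝ) : Prop :=
  HasHilbertSamuelMultiplicity (F.LocalFiberCone J) e

/-! Write Q_i = (x_1, …, x_i) and let H_i(n) be the length of (I_n + Q_i)/(J I_n + Q_i), the Hilbert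
function of the fiber cone of F/Q_i. Everything rests on the recursion H_i(n+1) = H_i(n) +
H_{i+1}(n+1) for large n (`IsWeakFCElement.exists_hilbertMod_add`). Multiplication by x_{i+1} embeds
degree n of that fiber cone into degree n+1: this uses (FC₁) with exponent 1, and (FC₂) together
with Artin–Rees. (FC₁) with exponent 0 identifies the cokernel.

Reduction: if no I_n were contained in Q_ℓ, then H_ℓ ≥ 1 everywhere, and ℓ discrete integrations
would give H_0(n) ≥ C n^ℓ, hence partial sums of order at least n^{ℓ+1}. But H_0 is at most l(A/J)
times the Hilbert function of F_𝔪(F), whose partial sums are O(n^ℓ) because that ring has dimension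
at most ℓ. So I_n ⊆ Q_ℓ for large n, and (FC₁), applied to one x_i after another, turns this into
I_{n+1} = Q_ℓ I_n.

Multiplicities: now H_ℓ is eventually zero, so H_{ℓ-1} is eventually a constant e, positive because
F/Q_{ℓ-1} is not nilpotent. Integrating, H_i(n) is asymptotic to e n^j / j! with j = ℓ - 1 - i.
Replacing Q_i by its saturation P(i) does not change the Hilbert function in large degrees, by
Artin–Rees. The Hilbert–Samuel function of the localized fiber cone lies between partial sums of the
Hilbert function shifted by bounded amounts. Its dimension is j + 1: at most, since j + 1 elements
generate the reduction modulo Q_i; at least, by the growth just found. Hence every multiplicity is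
e.

Colengths: all of them are lengths of the Rees algebra of F modulo the ideal K(P) of elements whose
degree n coefficient lies in J I_n + 𝔞 I_{n-1} + P. K(P) grows with P, and K(0) has finite colength.
So equality of colengths means K(P) = K(0), a condition on each degree that is automatic above the
reduction number. -/

/-- The length of `M / N` for submodules `N ≤ M`. -/
noncomputable def Submodule.relLength {A : Type*} {E : Type*} [CommRing A] [AddCommGroup E]
    [Module A E] (N M : Submodule A E) : ℕ∞ :=
  Module.length A (M ⧸ N.submoduleOf M)

/-! ### Lengths of subquotients. -/

namespace Submodule

section RelLength

variable {A E E' : Type*} [CommRing A] [AddCommGroup E] [Module A E] [AddCommGroup E'] [Module A E']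

lemma submoduleOf_le_comap_restrict {N M : Submodule A E} {N' M' : Submodule A E'} (f : E →ₗ[A] E')
    (hM : ∀ a ∈ M, f a ∈ M') (hN : ∀ a ∈ N, a ∈ M → f a ∈ N') :
    N.submoduleOf M ≤ (N'.submoduleOf M').comap (f.restrict hM) :=
  fun x hx => hN x hx x.2

/-- The map `M / N → M' / N'` induced by a linear map. -/
def relMap {N M : Submodule A E} {N' M' : Submodule A E'} (f : E →ₗ[A] E')
    (hM : ∀ a ∈ M, f a ∈ M') (hN : ∀ a ∈ N, a ∈ M → f a ∈ N') :
    (M ⧸ N.submoduleOf M) →ₗ[A] (M' ⧸ N'.submoduleOf M') :=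
  mapQ (N.submoduleOf M) (N'.submoduleOf M') (f.restrict hM) (submoduleOf_le_comap_restrict f hM hN)

lemma relMap_mk {N M : Submodule A E} {N' M' : Submodule A E'} (f : E →ₗ[A] E')
    (hM : ∀ a ∈ M, f a ∈ M') (hN : ∀ a ∈ N, a ∈ M → f a ∈ N') (y : M) :
    relMap f hM hN (Quotient.mk y) = Quotient.mk ⟨f y, hM _ y.2⟩ := rfl

lemma relMap_injective {N M : Submodule A E} {N' M' : Submodule A E'} (f : E →ₗ[A] E')
    (hM : ∀ a ∈ M, f a ∈ M') (hN : ∀ a ∈ N, a ∈ M → f a ∈ N') (h : ∀ a ∈ M, f a ∈ N' → a ∈ N) :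
    Function.Injective (relMap (N := N) (N' := N') f hM hN) := by
  rw [← LinearMap.ker_eq_bot, LinearMap.ker_eq_bot']
  intro y hy
  obtain ⟨y, rfl⟩ := mkQ_surjective _ y
  rw [mkQ_apply, relMap_mk, Quotient.mk_eq_zero] at hy
  rw [mkQ_apply, Quotient.mk_eq_zero]
  exact h y y.2 hy

lemma relMap_surjective {N M : Submodule A E} {N' M' : Submodule A E'} (f : E →ₗ[A] E')
    (hM : ∀ a ∈ M, f a ∈ M') (hN : ∀ a ∈ N, a ∈ M → f a ∈ N')
    (hs : ∀ b ∈ M', ∃ a ∈ M, b - f a ∈ N') :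
    Function.Surjective (relMap (N := N) (N' := N') f hM hN) := by
  intro y
  obtain ⟨y, rfl⟩ := mkQ_surjective _ y
  obtain ⟨a, ha, h⟩ := hs y y.2
  refine ⟨Quotient.mk ⟨a, ha⟩, ?_⟩
  rw [mkQ_apply, relMap_mk, eq_comm, Quotient.eq]
  exact h

lemma relLength_add {K N M : Submodule A E} (hKN : K ≤ N) (hNM : N ≤ M) :
    K.relLength M = K.relLength N + N.relLength M := by
  refine Module.length_eq_add_of_exact
    (relMap (N := K) (N' := K) LinearMap.id (fun _ h => hNM h) (fun x hx _ => hx))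
    (relMap (N := K) (N' := N) LinearMap.id (fun _ h => h) (fun x hx _ => hKN hx))
    (relMap_injective _ _ _ fun a _ h => h)
    (relMap_surjective _ _ _ fun b hb => ⟨b, hb, by simp⟩) ?_
  intro y
  obtain ⟨y, rfl⟩ := mkQ_surjective _ y
  rw [mkQ_apply, relMap_mk, Quotient.mk_eq_zero]
  constructor
  · intro hy
    exact ⟨Quotient.mk ⟨y, hy⟩, rfl⟩
  · rintro ⟨z, hz⟩
    obtain ⟨z, rfl⟩ := mkQ_surjective _ z
    rw [mkQ_apply, relMap_mk, Quotient.eq] at hz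
    have h1 : (z : E) - y ∈ N := hKN hz
    change (y : E) ∈ N
    rw [← sub_sub_cancel (z : E) y]
    exact N.sub_mem z.2 h1

lemma relLength_le_of_surjective {N M : Submodule A E} {N' M' : Submodule A E'} (f : E →ₗ[A] E')
    (hM : ∀ a ∈ M, f a ∈ M') (hN : ∀ a ∈ N, a ∈ M → f a ∈ N')
    (hs : ∀ b ∈ M', ∃ a ∈ M, b - f a ∈ N') :
    N'.relLength M' ≤ N.relLength M :=
  Module.length_le_of_surjective (relMap f hM hN) (relMap_surjective _ _ _ hs)

/-- The tool behind nearly every length identity below: the isomorphism of subquotients is checked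
on elements of the ambient modules. -/
lemma relLength_eq_of_linearMap {N M : Submodule A E} {N' M' : Submodule A E'} (f : E →ₗ[A] E')
    (hM : ∀ a ∈ M, f a ∈ M') (hN : ∀ a ∈ M, f a ∈ N' ↔ a ∈ N)
    (hs : ∀ b ∈ M', ∃ a ∈ M, b - f a ∈ N') :
    N.relLength M = N'.relLength M' :=
  (LinearEquiv.ofBijective (relMap f hM (fun a ha h => (hN a h).2 ha))
    ⟨relMap_injective _ _ _ fun a h h' => (hN a h).1 h', relMap_surjective _ _ _ hs⟩).length_eq

lemma relLength_top (N : Submodule A E) : N.relLength ⊤ = Module.length A (E ⧸ N) := by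
  refine (Quotient.equiv (N.submoduleOf ⊤) N topEquiv ?_).length_eq
  ext a
  exact ⟨fun ⟨b, hb, h⟩ => h ▸ hb, fun h => ⟨⟨a, trivial⟩, h, rfl⟩⟩

lemma relLength_eq_zero_iff {N M : Submodule A E} : N.relLength M = 0 ↔ M ≤ N := by
  rw [relLength, Module.length_eq_zero_iff, Submodule.Quotient.subsingleton_iff,
    submoduleOf_eq_top]

/-- Lengths attached to F/Q are formed over A/Q; this moves them to A. -/
lemma relLength_restrictScalars {B : Type*} [CommRing B] [Algebra B A] [Module B E]
    [IsScalarTower B A E] (h : Function.Surjective (algebraMap B A)) (N M : Submodule A E) :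
    (N.restrictScalars B).relLength (M.restrictScalars B) = N.relLength M :=
  Eq.trans (LinearEquiv.length_eq (R := B) (Submodule.Quotient.restrictScalarsEquiv B
    (N.submoduleOf M))) (Module.length_eq_of_surjective h)

/-- A module with `n` generators that is killed by `J` has length at most `n · l(A/J)`. -/
lemma relLength_smul_le (J : Ideal A) (N : Submodule A E) (hN : N.FG) :
    (J • N).relLength N ≤ N.spanFinrank * Module.length A (A ⧸ J) := by
  obtain ⟨s, hs, hsN⟩ := hN.exists_span_finset_card_eq_spanFinrank
  classical
  rw [← hs]
  -- The bound is the length of (A/J)^s, which surjects onto N/JN.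
  have h1 : ((s.card : ℕ) : ℕ∞) * Module.length A (A ⧸ J) =
      (Submodule.pi Set.univ (fun _ : s => J)).relLength (⊤ : Submodule A (s → A)) := by
    rw [relLength_top, (Submodule.quotientPi (fun _ : s => J)).length_eq]
    simp
  rw [h1]
  refine relLength_le_of_surjective (Fintype.linearCombination A (fun i : s => (i : E)))
    (fun a _ => ?_) (fun a ha _ => ?_) (fun b hb => ?_)
  · rw [Fintype.linearCombination_apply]
    exact N.sum_mem fun i _ => N.smul_mem _ (hsN ▸ subset_span i.2)
  · rw [Fintype.linearCombination_apply]
    exact Submodule.sum_mem _ fun i _ =>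
      smul_mem_smul (ha i trivial) (hsN ▸ subset_span i.2)
  · rw [← hsN] at hb
    have hr : LinearMap.range (Fintype.linearCombination A (fun i : s => (i : E))) =
      span A (s : Set E) := by
      rw [Fintype.range_linearCombination]; simp
    rw [← hr] at hb
    obtain ⟨a, rfl⟩ := hb
    exact ⟨a, trivial, by simp⟩

/-- By Nakayama, minimal generators of N give a basis of N/𝔪N. For N = Iₙ this makes the number of
generators a value of the Hilbert function of F_𝔪(F). -/
lemma spanFinrank_eq_relLength_maximalIdeal [IsLocalRing A] (N : Submodule A E) (hN : N.FG) :
    (N.spanFinrank : ℕ∞) = (IsLocalRing.maximalIdeal A • N).relLength N := by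
  rw [IsLocalRing.spanFinrank_eq_finrank_quotient N hN]
  let : Field (A ⧸ IsLocalRing.maximalIdeal A) := Ideal.Quotient.field _
  have : Module.Finite A N := Module.Finite.iff_fg.2 hN
  have : Module.Finite (A ⧸ IsLocalRing.maximalIdeal A)
      (N ⧸ IsLocalRing.maximalIdeal A • (⊤ : Submodule A N)) :=
    Module.Finite.of_restrictScalars_finite A _ _
  rw [← Module.length_eq_finrank, ← Module.length_eq_of_surjective (S := A)
    Ideal.Quotient.mk_surjective, ← relLength_top]
  refine relLength_eq_of_linearMap N.subtype (fun a _ => a.2) (fun a _ => ?_)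
    (fun b hb => ⟨⟨b, hb⟩, trivial, by simp⟩)
  have : IsLocalRing.maximalIdeal A • N =
      (IsLocalRing.maximalIdeal A • (⊤ : Submodule A N)).map N.subtype := by
    rw [map_smul'', Submodule.map_top, range_subtype]
  rw [this]
  constructor
  · rintro ⟨b, hb, h⟩
    rwa [← Subtype.ext (h : (b : E) = a)]
  · intro h
    exact ⟨a, h, rfl⟩

end RelLength

end Submodule

/-! ### Lengths and dimension over local rings. -/

section LocalLength

/-- If the local ring `A` surjects onto the residue field of the local ring `R`, lengths over `A`
and over `R` agree. -/
lemma IsLocalRing.length_eq_of_residue_surjective {A R M : Type*} [CommRing A] [CommRing R]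
    [IsLocalRing A] [IsLocalRing R] [Algebra A R] [IsLocalHom (algebraMap A R)]
    [AddCommGroup M] [Module R M] [Module A M] [IsScalarTower A R M]
    (h : ∀ r : R, ∃ a : A, r - algebraMap A R a ∈ IsLocalRing.maximalIdeal R) :
    Module.length A M = Module.length R M := by
  have hs : Function.Surjective (algebraMap (ResidueField A) (ResidueField R)) := by
    intro r
    obtain ⟨r, rfl⟩ := IsLocalRing.residue_surjective r
    obtain ⟨a, ha⟩ := h r
    exact ⟨residue A a, (Ideal.Quotient.eq.2 ha).symm⟩
  rw [IsLocalRing.length_restrictScalars A R M, Module.length_eq_of_surjective hs,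
    Module.length_eq_one (IsLocalRing.ResidueField R) (IsLocalRing.ResidueField R), mul_one]

lemma IsLocalRing.length_quotient_ne_top {A : Type*} [CommRing A] [IsLocalRing A]
    [IsNoetherianRing A] {J : Ideal A} {c : ℕ} (hJ : IsLocalRing.maximalIdeal A ^ c ≤ J) :
    Module.length A (A ⧸ J) ≠ ⊤ := by
  by_cases hJt : J = ⊤
  · subst hJt
    have : Subsingleton (A ⧸ (⊤ : Ideal A)) := Ideal.Quotient.subsingleton_iff.2 rfl
    rw [Module.length_eq_zero]
    simp
  have hmin : IsLocalRing.maximalIdeal A ∈ J.minimalPrimes := by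
    refine ⟨⟨inferInstance, IsLocalRing.le_maximalIdeal hJt⟩, fun q hq _ => ?_⟩
    exact hq.1.le_of_pow_le (hJ.trans hq.2)
  have := IsLocalRing.quotient_artinian_of_mem_minimalPrimes_of_isLocalRing J hmin
  rw [Module.length_eq_of_surjective (S := A) (R := A ⧸ J) Ideal.Quotient.mk_surjective]
  exact Module.length_ne_top

lemma Module.length_quotient_anti {A S : Type*} [CommRing A] [CommRing S] [Algebra A S]
    {I J : Ideal S} (h : I ≤ J) : Module.length A (S ⧸ J) ≤ Module.length A (S ⧸ I) :=
  Module.length_le_of_surjective ((Submodule.factor h).restrictScalars A)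
    (Submodule.factor_surjective h)

/-- Multiplication by a maps A/(I + (b)) onto (I + (a))/(I + (ab)). -/
lemma Module.length_quotient_sup_mul_le {A : Type*} [CommRing A] (I : Ideal A) (a b : A) :
    Module.length A (A ⧸ (I ⊔ Ideal.span {a * b})) ≤
      Module.length A (A ⧸ (I ⊔ Ideal.span {a})) + Module.length A (A ⧸ (I ⊔ Ideal.span {b})) := by
  have h1 : I ⊔ Ideal.span {a * b} ≤ I ⊔ Ideal.span {a} := by
    refine sup_le_sup_left ?_ _
    rw [Ideal.span_singleton_le_span_singleton]
    exact dvd_mul_right a b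
  rw [← Submodule.relLength_top, ← Submodule.relLength_top, ← Submodule.relLength_top,
    Submodule.relLength_add h1 le_top, add_comm]
  gcongr
  refine Submodule.relLength_le_of_surjective (LinearMap.mulLeft A a) (fun x _ => ?_)
    (fun x hx _ => ?_) (fun x hx => ?_)
  · exact Submodule.mem_sup_right (Ideal.mem_span_singleton.2 (dvd_mul_right a x))
  · obtain ⟨y, hy, z, hz, rfl⟩ := Submodule.mem_sup.1 hx
    obtain ⟨z, rfl⟩ := Ideal.mem_span_singleton.1 hz
    rw [map_add]
    refine Submodule.add_mem_sup (I.mul_mem_left a hy) (Ideal.mem_span_singleton.2 ⟨z, ?_⟩)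
    simp [mul_assoc]
  · obtain ⟨y, hy, z, hz, rfl⟩ := Submodule.mem_sup.1 hx
    obtain ⟨z, rfl⟩ := Ideal.mem_span_singleton.1 hz
    exact ⟨z, trivial, Submodule.mem_sup_left (by simpa using hy)⟩

lemma Module.length_quotient_sup_pow_le {A : Type*} [CommRing A] (I : Ideal A) (a : A) (n : ℕ) :
    Module.length A (A ⧸ (I ⊔ Ideal.span {a ^ n})) ≤
      n * Module.length A (A ⧸ (I ⊔ Ideal.span {a})) := by
  induction n with
  | zero =>
    have : I ⊔ Ideal.span {a ^ 0} = ⊤ := by simp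
    rw [this]
    have : Subsingleton (A ⧸ (⊤ : Ideal A)) := Ideal.Quotient.subsingleton_iff.2 rfl
    simp [Module.length_eq_zero]
  | succ n ih =>
    rw [pow_succ]
    refine (Module.length_quotient_sup_mul_le I _ _).trans ?_
    push_cast
    rw [add_mul, one_mul]
    gcongr

/-- The elements are raised to the n-th power one at a time, the others being absorbed into I; hence
the induction over all I. -/
lemma Module.length_quotient_sup_span_pow_le {A : Type*} [CommRing A] (s : Finset A) (n : ℕ)
    (I : Ideal A) :
    Module.length A (A ⧸ (I ⊔ Ideal.span ((fun a => a ^ n) '' (s : Set A)))) ≤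
      (n : ℕ∞) ^ s.card * Module.length A (A ⧸ (I ⊔ Ideal.span (s : Set A))) := by
  classical
  induction s using Finset.induction_on generalizing I with
  | empty => rw [Finset.coe_empty, Set.image_empty, Finset.card_empty, pow_zero, one_mul]
  | insert a s ha ih =>
    rw [Finset.coe_insert, Set.image_insert_eq, Ideal.span_insert, Ideal.span_insert,
      Finset.card_insert_of_notMem ha, ← sup_assoc, ← sup_assoc]
    refine (ih _).trans ?_
    rw [pow_succ, mul_assoc]
    gcongr
    have e (b : A) : I ⊔ Ideal.span {b} ⊔ Ideal.span (s : Set A) =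
      I ⊔ Ideal.span (s : Set A) ⊔ Ideal.span {b} := sup_right_comm _ _ _
    rw [e, e]
    exact Module.length_quotient_sup_pow_le _ a n

/-- The Hilbert–Samuel function of a local ring of dimension `d` is `O(n ^ d)`. -/
lemma IsLocalRing.exists_length_quotient_pow_le {R : Type*} [CommRing R] [IsLocalRing R]
    [IsNoetherianRing R] {d : ℕ} (hd : ringKrullDim R = d) :
    ∃ C : ℕ, ∀ n : ℕ,
      Module.length R (R ⧸ IsLocalRing.maximalIdeal R ^ n) ≤ (C * n ^ d : ℕ) := by
  -- A system of parameters: the maximal ideal is minimal over an ideal with d generators.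
  obtain ⟨s, hs, hcard⟩ :=
    Ideal.exists_finset_card_eq_height_of_isNoetherianRing (IsLocalRing.maximalIdeal R)
  have hd' : s.card = d := by
    have h1 := IsLocalRing.maximalIdeal_height_eq_ringKrullDim (R := R)
    rw [hd, ← hcard] at h1
    exact_mod_cast h1
  have := IsLocalRing.quotient_artinian_of_mem_minimalPrimes_of_isLocalRing _ hs
  have hfin : Module.length R (R ⧸ Ideal.span (s : Set R)) ≠ ⊤ := by
    rw [Module.length_eq_of_surjective (S := R) (R := R ⧸ Ideal.span (s : Set R))
      Ideal.Quotient.mk_surjective]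
    exact Module.length_ne_top
  obtain ⟨C, hC⟩ := ENat.ne_top_iff_exists.1 hfin
  refine ⟨C, fun n => ?_⟩
  have h1 : Ideal.span ((fun a => a ^ n) '' (s : Set R)) ≤ IsLocalRing.maximalIdeal R ^ n := by
    rw [Ideal.span_le]
    rintro _ ⟨a, ha, rfl⟩
    exact Ideal.pow_mem_pow (hs.1.2 (Ideal.subset_span ha)) n
  refine (Module.length_quotient_anti h1).trans ?_
  have h2 := Module.length_quotient_sup_span_pow_le s n ⊥
  rw [bot_sup_eq, bot_sup_eq, ← hC, hd'] at h2
  refine h2.trans (le_of_eq ?_)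
  push_cast
  ring

/-- If some power of the maximal ideal lies in an ideal with `d` generators, the dimension is at
most `d`. -/
lemma IsLocalRing.ringKrullDim_le_card_of_pow_le {R : Type*} [CommRing R] [IsLocalRing R]
    [IsNoetherianRing R] (s : Finset R) (hs : (s : Set R) ⊆ IsLocalRing.maximalIdeal R) {n : ℕ}
    (hn : IsLocalRing.maximalIdeal R ^ n ≤ Ideal.span (s : Set R)) :
    ringKrullDim R ≤ s.card := by
  rw [← IsLocalRing.maximalIdeal_height_eq_ringKrullDim]
  have : (IsLocalRing.maximalIdeal R) ∈ (Ideal.span (s : Set R)).minimalPrimes := by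
    refine ⟨⟨inferInstance, Ideal.span_le.2 hs⟩, fun q hq _ => ?_⟩
    exact hq.1.le_of_pow_le (hn.trans hq.2)
  exact_mod_cast Ideal.height_le_card_of_mem_minimalPrimes_span_finset this

end LocalLength

/-! ### Asymptotics of real sequences under summation and shifts. -/

section Growth

/-- The quotient is the sum of the j + 1 powers ((n+1)/n)^i, each tending to 1. -/
lemma tendsto_succ_pow_sub_pow_div (j : ℕ) :
    Tendsto (fun n : ℕ => (((n : ℝ) + 1) ^ (j + 1) - (n : ℝ) ^ (j + 1)) / (n : ℝ) ^ j) atTop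
      (𝓝 (j + 1)) := by
  have h1 : Tendsto (fun n : ℕ => ((n : ℝ) + 1) / n) atTop (𝓝 1) := by
    have := (tendsto_one_div_atTop_nhds_zero_nat (𝕜 := ℝ)).const_add 1
    rw [add_zero] at this
    refine this.congr' ?_
    filter_upwards [eventually_gt_atTop 0] with n hn
    have : (n : ℝ) ≠ 0 := by positivity
    field_simp
  have h2 : Tendsto (fun n : ℕ => ∑ i ∈ Finset.range (j + 1), (((n : ℝ) + 1) / n) ^ i) atTop
      (𝓝 (∑ i ∈ Finset.range (j + 1), (1 : ℝ) ^ i)) :=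
    tendsto_finsetSum _ fun i _ => h1.pow i
  simp only [one_pow, Finset.sum_const, Finset.card_range, nsmul_eq_mul, mul_one,
    Nat.cast_add, Nat.cast_one] at h2
  refine h2.congr' ?_
  filter_upwards [eventually_gt_atTop 0] with n hn
  have hn' : (n : ℝ) ≠ 0 := by positivity
  have h3 := (Commute.all ((n : ℝ) + 1) n).geom_sum₂_mul (j + 1)
  rw [add_sub_cancel_left, mul_one] at h3
  rw [← h3, Finset.sum_div]
  refine Finset.sum_congr rfl fun i hi => ?_
  have hij : i ≤ j := by simpa [Nat.lt_succ_iff] using hi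
  rw [div_pow, div_eq_div_iff (pow_ne_zero _ hn') (pow_ne_zero _ hn'), mul_assoc, ← pow_add]
  congr 2
  omega

/-- A discrete form of `∫ xʲ = xʲ⁺¹ / (j + 1)`. -/
lemma tendsto_sum_range_div_pow {f : ℕ → ℝ} {j : ℕ} {c : ℝ}
    (h : Tendsto (fun n : ℕ => f n / (n : ℝ) ^ j) atTop (𝓝 c)) :
    Tendsto (fun n : ℕ => (∑ k ∈ Finset.range n, f k) / (n : ℝ) ^ (j + 1)) atTop
      (𝓝 (c / (j + 1))) := by
  -- Positive weights that telescope to n^(j+1) and are asymptotic to (j+1) n^j; a little-o estimate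
  -- against them can be summed.
  set g : ℕ → ℝ := fun n => ((n : ℝ) + 1) ^ (j + 1) - (n : ℝ) ^ (j + 1) with hg
  have hgpos : ∀ n, 0 < g n := fun n => by
    have : (n : ℝ) ^ (j + 1) < ((n : ℝ) + 1) ^ (j + 1) :=
      pow_lt_pow_left₀ (by linarith) (by positivity) (by omega)
    simp only [hg]; linarith
  have hsum : ∀ n, ∑ k ∈ Finset.range n, g k = (n : ℝ) ^ (j + 1) := fun n => by
    have := Finset.sum_range_sub (fun k : ℕ => (k : ℝ) ^ (j + 1)) n
    simpa [hg] using this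
  have hj : (j : ℝ) + 1 ≠ 0 := by positivity
  have h1 : Tendsto (fun n => f n / g n) atTop (𝓝 (c / (j + 1))) := by
    refine (h.div (tendsto_succ_pow_sub_pow_div j) hj).congr' ?_
    filter_upwards [eventually_gt_atTop 0] with n hn
    have : (n : ℝ) ^ j ≠ 0 := by positivity
    exact div_div_div_cancel_right₀ this _ _
  have h2 : (fun n => f n - c / (j + 1) * g n) =o[atTop] g := by
    rw [Asymptotics.isLittleO_iff_tendsto (fun n hn => absurd hn (hgpos n).ne')]
    have := h1.sub_const (c / (j + 1))
    rw [sub_self] at this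
    refine this.congr fun n => ?_
    rw [sub_div, mul_div_cancel_right₀ _ (hgpos n).ne']
  have h3 := h2.sum_range (fun n => (hgpos n).le) (by
    simp only [hsum]
    exact (tendsto_pow_atTop (by omega)).comp tendsto_natCast_atTop_atTop)
  simp only [hsum, Finset.sum_sub_distrib, ← Finset.mul_sum] at h3
  have h4 := (h3.tendsto_div_nhds_zero).add_const (c / (j + 1))
  rw [zero_add] at h4
  refine h4.congr' ?_
  filter_upwards [eventually_gt_atTop 0] with n hn
  have : (n : ℝ) ^ (j + 1) ≠ 0 := by positivity
  rw [sub_div, mul_div_cancel_right₀ _ this, sub_add_cancel]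

lemma tendsto_div_pow_of_sub {f g : ℕ → ℝ} {j : ℕ} {c : ℝ}
    (h : Tendsto (fun n : ℕ => g n / (n : ℝ) ^ j) atTop (𝓝 c))
    (hfg : ∀ᶠ n in atTop, f (n + 1) - f n = g n) :
    Tendsto (fun n : ℕ => f n / (n : ℝ) ^ (j + 1)) atTop (𝓝 (c / (j + 1))) := by
  have h1 : Tendsto (fun n : ℕ => (f (n + 1) - f n) / (n : ℝ) ^ j) atTop (𝓝 c) := by
    refine h.congr' ?_
    filter_upwards [hfg] with n hn
    rw [hn]
  have h2 := tendsto_sum_range_div_pow h1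
  simp only [Finset.sum_range_sub] at h2
  have h3 : Tendsto (fun n : ℕ => f 0 / (n : ℝ) ^ (j + 1)) atTop (𝓝 0) :=
    tendsto_const_nhds.div_atTop
      ((tendsto_pow_atTop (by omega)).comp tendsto_natCast_atTop_atTop)
  have h4 := h2.add h3
  rw [add_zero] at h4
  exact h4.congr fun n => by ring

lemma tendsto_shift_div_pow {f : ℕ → ℝ} {j : ℕ} {c : ℝ} (a : ℕ)
    (h : Tendsto (fun n : ℕ => f n / (n : ℝ) ^ j) atTop (𝓝 c)) :
    Tendsto (fun n : ℕ => f (n + a) / (n : ℝ) ^ j) atTop (𝓝 c) := by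
  have h1 : Tendsto (fun n : ℕ => ((n + a : ℕ) : ℝ) / n) atTop (𝓝 1) := by
    have := (tendsto_const_div_atTop_nhds_zero_nat (a : ℝ)).const_add 1
    rw [add_zero] at this
    refine this.congr' ?_
    filter_upwards [eventually_gt_atTop 0] with n hn
    have : (n : ℝ) ≠ 0 := by positivity
    push_cast
    field_simp
  have h2 := (h.comp (tendsto_add_atTop_nat a)).mul (h1.pow j)
  rw [one_pow, mul_one] at h2
  refine h2.congr' ?_
  filter_upwards [eventually_gt_atTop 0] with n hn
  have h3 : (n : ℝ) ≠ 0 := by positivity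
  have h4 : ((n + a : ℕ) : ℝ) ≠ 0 := by positivity
  simp only [Function.comp]
  rw [div_pow]
  field_simp

lemma tendsto_shift_sub_div_pow {f : ℕ → ℝ} {j : ℕ} {c : ℝ} (a : ℕ)
    (h : Tendsto (fun n : ℕ => f n / (n : ℝ) ^ j) atTop (𝓝 c)) :
    Tendsto (fun n : ℕ => f (n - a) / (n : ℝ) ^ j) atTop (𝓝 c) := by
  have h1 : Tendsto (fun n : ℕ => ((n + a : ℕ) : ℝ) ^ j / (n : ℝ) ^ j) atTop (𝓝 1) := by
    refine tendsto_shift_div_pow (f := fun n => (n : ℝ) ^ j) a ?_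
    refine tendsto_const_nhds.congr' ?_
    filter_upwards [eventually_gt_atTop 0] with n hn
    have : (n : ℝ) ^ j ≠ 0 := by positivity
    exact (div_self this).symm
  rw [← tendsto_add_atTop_iff_nat a]
  have h2 := h.div h1 one_ne_zero
  rw [div_one] at h2
  refine h2.congr' ?_
  filter_upwards [eventually_gt_atTop 0] with n hn
  have h3 : (n : ℝ) ^ j ≠ 0 := by positivity
  have h4 : ((n + a : ℕ) : ℝ) ^ j ≠ 0 := by positivity
  rw [Nat.add_sub_cancel, Pi.div_apply]
  field_simp

/-- Discrete integration of a lower bound: f(n) exceeds a constant plus c ∑ k^j, which is asymptotic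
to c n^(j+1)/(j+1). -/
lemma exists_mul_pow_succ_le {f g : ℕ → ℝ} {j : ℕ}
    (hg : ∃ c > 0, ∀ᶠ n : ℕ in atTop, c * (n : ℝ) ^ j ≤ g n)
    (hfg : ∀ᶠ n in atTop, f n + g n ≤ f (n + 1)) :
    ∃ c > 0, ∀ᶠ n : ℕ in atTop, c * (n : ℝ) ^ (j + 1) ≤ f n := by
  obtain ⟨c, hc, hg⟩ := hg
  obtain ⟨N, hN⟩ := eventually_atTop.1 (hg.and hfg)
  have h1 : Tendsto (fun n : ℕ => (n : ℝ) ^ j / (n : ℝ) ^ j) atTop (𝓝 1) := by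
    refine tendsto_const_nhds.congr' ?_
    filter_upwards [eventually_gt_atTop 0] with n hn
    have : (n : ℝ) ^ j ≠ 0 := by positivity
    exact (div_self this).symm
  set S : ℕ → ℝ := fun n => ∑ k ∈ Finset.range n, (k : ℝ) ^ j with hS
  have h2 : Tendsto (fun n : ℕ => S n / (n : ℝ) ^ (j + 1)) atTop (𝓝 (1 / (j + 1))) :=
    tendsto_sum_range_div_pow h1
  have h3 : ∀ n, N ≤ n → f N - c * S N + c * S n ≤ f n := by
    intro n hn
    induction n, hn using Nat.le_induction with
    | base => linarith
    | succ n hn ih =>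
      have h4 := hN n hn
      have h5 : S (n + 1) = S n + (n : ℝ) ^ j := Finset.sum_range_succ _ _
      rw [h5]
      linarith [h4.1, h4.2]
  have h4 : Tendsto (fun n : ℕ => (f N - c * S N) / (n : ℝ) ^ (j + 1)) atTop (𝓝 0) :=
    tendsto_const_nhds.div_atTop
      ((tendsto_pow_atTop (by omega)).comp tendsto_natCast_atTop_atTop)
  have h5 := h4.add (h2.const_mul c)
  have hpos : 0 < c * (1 / ((j : ℝ) + 1)) := by positivity
  rw [zero_add] at h5
  -- Half of the limiting constant, so that the bound holds eventually.
  refine ⟨c * (1 / ((j : ℝ) + 1)) / 2, by positivity, ?_⟩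
  filter_upwards [h5.eventually_const_le (half_lt_self hpos), eventually_ge_atTop N,
    eventually_gt_atTop 0] with n h6 h7 h8
  have h9 : (0 : ℝ) < (n : ℝ) ^ (j + 1) := by positivity
  have h10 : (f N - c * S N + c * S n) / (n : ℝ) ^ (j + 1) ≤ f n / (n : ℝ) ^ (j + 1) := by
    gcongr
    exact h3 n h7
  rw [← le_div_iff₀ h9]
  refine h6.trans (le_trans (le_of_eq ?_) h10)
  ring

end Growth

/-! ### The Rees algebra, degree by degree. -/

namespace IdealFiltration

section Rees

variable {A : Type u} [CommRing A] (F : IdealFiltration A)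

lemma ideal_antitone : Antitone F.ideal := antitone_nat_of_succ_le F.ideal_succ_le

/-- The element `a tⁿ` of the Rees algebra. -/
noncomputable def reesMonomial {n : ℕ} {a : A} (ha : a ∈ F.ideal n) : F.rees :=
  ⟨monomial n a, fun k => by
    rw [coeff_monomial]
    split_ifs with h
    · exact h ▸ ha
    · exact Ideal.zero_mem _⟩

variable {F}

@[simp] lemma coe_reesMonomial {n : ℕ} {a : A} (ha : a ∈ F.ideal n) :
    (F.reesMonomial ha : A[X]) = monomial n a := rfl

/-- The coefficients of the elements of an ideal of the Rees algebra that are homogeneous of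
degree `n`. -/
noncomputable def degreePart (K : Ideal F.rees) (n : ℕ) : Ideal A where
  carrier := {a | ∃ f ∈ K, (f : A[X]) = monomial n a}
  add_mem' := by
    rintro a b ⟨f, hf, hfa⟩ ⟨g, hg, hgb⟩
    exact ⟨f + g, K.add_mem hf hg, by simp [hfa, hgb]⟩
  zero_mem' := ⟨0, K.zero_mem, by simp⟩
  smul_mem' := by
    rintro c a ⟨f, hf, hfa⟩
    refine ⟨c • f, ?_, by simp [hfa, smul_monomial]⟩
    rw [Algebra.smul_def]
    exact K.mul_mem_left _ hf

lemma degreePart_mono {K L : Ideal F.rees} (h : K ≤ L) (n : ℕ) :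
    degreePart K n ≤ degreePart L n :=
  fun _ ⟨f, hf, e⟩ => ⟨f, h hf, e⟩

lemma degreePart_mul (K L : Ideal F.rees) (m n : ℕ) :
    degreePart K m * degreePart L n ≤ degreePart (K * L) (m + n) := by
  rw [Ideal.mul_le]
  rintro a ⟨f, hf, hfa⟩ b ⟨g, hg, hgb⟩
  exact ⟨f * g, Ideal.mul_mem_mul hf hg, by simp [hfa, hgb, monomial_mul_monomial]⟩

lemma ideal_le_degreePart_top (n : ℕ) : F.ideal n ≤ degreePart (F := F) ⊤ n :=
  fun _ ha => ⟨F.reesMonomial ha, trivial, rfl⟩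

lemma degreePart_mul_ideal_le (K : Ideal F.rees) (m n : ℕ) :
    degreePart K m * F.ideal n ≤ degreePart K (m + n) :=
  (Ideal.mul_mono_right (ideal_le_degreePart_top n)).trans
    ((degreePart_mul K ⊤ m n).trans (degreePart_mono Ideal.mul_le_left _))

lemma degreePart_pow (K : Ideal F.rees) (n : ℕ) :
    degreePart K 1 ^ n ≤ degreePart (K ^ n) n := by
  induction n with
  | zero =>
    rw [pow_zero, pow_zero, Ideal.one_eq_top, Ideal.one_eq_top, ← F.ideal_zero]
    exact ideal_le_degreePart_top (F := F) 0
  | succ n ih =>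
    rw [pow_succ, pow_succ]
    exact (Ideal.mul_mono_left ih).trans (degreePart_mul _ _ _ _)

/-- An element is the sum of its homogeneous components. This reduces containments in an ideal of
the Rees algebra to containments in A, one degree at a time. -/
lemma mem_of_forall_coeff_mem {K : Ideal F.rees} {f : F.rees}
    (h : ∀ n, (f : A[X]).coeff n ∈ degreePart K n) : f ∈ K := by
  choose g hg hgf using h
  have : f = ∑ n ∈ (f : A[X]).support, g n := by
    refine Subtype.ext ?_
    rw [AddSubmonoidClass.coe_finsetSum]
    simp only [hgf]
    exact (f : A[X]).as_sum_support
  rw [this]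
  exact K.sum_mem fun n _ => hg n

lemma mul_ideal_le_degreePart_fiberIdeal (J : Ideal A) (n : ℕ) :
    J * F.ideal n ≤ degreePart (F.fiberIdeal J) n := by
  intro a ha
  refine ⟨F.reesMonomial (Ideal.mul_le_right (I := J) ha), fun k => ?_, rfl⟩
  rw [coe_reesMonomial, coeff_monomial]
  split_ifs with h
  · exact h ▸ ha
  · exact Ideal.zero_mem _

lemma IsReduction.le_ideal_one {𝔟 : Ideal A} (h : F.IsReduction 𝔟) : 𝔟 ≤ F.ideal 1 := by
  simpa [F.ideal_zero] using h.1 0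

lemma IsReduction.exists_pow {𝔟 : Ideal A} (h : F.IsReduction 𝔟) :
    ∃ N, ∀ n k, N + n ≤ k → F.ideal k = 𝔟 ^ n * F.ideal (k - n) := by
  obtain ⟨N, hN⟩ := h.2
  refine ⟨N, fun n => ?_⟩
  induction n with
  | zero => intro k _; simp
  | succ n ih =>
    intro k hk
    rw [ih k (by omega), pow_succ, mul_assoc, ← hN (k - (n + 1)) (by omega)]
    congr 2
    omega

/-- The Rees algebra of a good filtration of a Noetherian ring is Noetherian. -/
lemma IsReduction.isNoetherianRing_rees [IsNoetherianRing A] {𝔟 : Ideal A}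
    (h : F.IsReduction 𝔟) : IsNoetherianRing F.rees := by
  classical
  obtain ⟨N, hN⟩ := h.2
  choose s hs using fun n => (IsNoetherian.noetherian (F.ideal n) : (F.ideal n).FG)
  obtain ⟨t, ht⟩ := (IsNoetherian.noetherian 𝔟 : 𝔟.FG)
  -- Algebra generators: generators of I₀, …, I_N in their own degrees, and 𝔟t, which produces all
  -- later degrees.
  set G : Finset A[X] := (Finset.range (N + 1)).biUnion (fun n => (s n).image (monomial n)) ∪
    t.image (monomial 1) with hG
  have hle (n : ℕ) (u : Finset A) (hu : u.image (monomial n) ⊆ G) :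
      Ideal.span (u : Set A) ≤
        (Subalgebra.toSubmodule (Algebra.adjoin A (G : Set A[X]))).comap (monomial n) := by
    rw [Ideal.span, Submodule.span_le]
    intro a ha
    exact Algebra.subset_adjoin (hu (Finset.mem_image_of_mem _ ha))
  have key (n : ℕ) : F.ideal n ≤
      (Subalgebra.toSubmodule (Algebra.adjoin A (G : Set A[X]))).comap (monomial n) := by
    induction n with
    | zero =>
      have := hle 0 (s 0) (Finset.subset_union_left.trans' fun x hx =>
        Finset.mem_biUnion.2 ⟨0, by simp, hx⟩)
      exact (hs 0).symm.le.trans this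
    | succ n ih =>
      by_cases hn : n + 1 < N + 1
      · have := hle (n + 1) (s (n + 1)) (Finset.subset_union_left.trans' fun x hx =>
          Finset.mem_biUnion.2 ⟨n + 1, by simpa using hn, hx⟩)
        exact (hs (n + 1)).symm.le.trans this
      · rw [hN n (by omega), Ideal.mul_le]
        intro a ha b hb
        have h1 : monomial 1 a ∈ Algebra.adjoin A (G : Set A[X]) := by
          have := hle 1 t Finset.subset_union_right
          exact this (ht.symm.le ha)
        have h2 : monomial n b ∈ Algebra.adjoin A (G : Set A[X]) := ih hb
        have h3 := mul_mem h1 h2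
        rw [monomial_mul_monomial, add_comm] at h3
        exact h3
  have heq : F.rees = Algebra.adjoin A (G : Set A[X]) := by
    refine le_antisymm (fun f hf => ?_) (Algebra.adjoin_le ?_)
    · rw [f.as_sum_support]
      exact sum_mem fun n _ => key n (hf n)
    · intro x hx
      rcases Finset.mem_union.1 hx with hx | hx
      · obtain ⟨n, _, hx⟩ := Finset.mem_biUnion.1 hx
        obtain ⟨a, ha, rfl⟩ := Finset.mem_image.1 hx
        exact (F.reesMonomial ((hs n).le (Submodule.subset_span ha))).2
      · obtain ⟨a, ha, rfl⟩ := Finset.mem_image.1 hx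
        exact (F.reesMonomial (h.le_ideal_one (ht.le (Submodule.subset_span ha)))).2
  have hfg : F.rees.FG := ⟨G, heq.symm⟩
  have : Algebra.FiniteType A F.rees := (Subalgebra.fg_iff_finiteType _).1 hfg
  exact Algebra.FiniteType.isNoetherianRing A F.rees

variable (F)

/-- The Hilbert function `n ↦ l(Iₙ / J Iₙ)` of the fiber cone. -/
noncomputable def hilbert (J : Ideal A) (n : ℕ) : ℕ∞ :=
  Submodule.relLength (J * F.ideal n) (F.ideal n)

/-- The ideal of all elements of the Rees algebra whose image in the fiber cone has order at
least `k`. -/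
def fiberTail (J : Ideal A) (k : ℕ) : Ideal F.rees where
  carrier := {f | ∀ n < k, (f : A[X]).coeff n ∈ J * F.ideal n}
  add_mem' := by
    intro f g hf hg n hn
    simpa using Ideal.add_mem _ (hf n hn) (hg n hn)
  zero_mem' := by
    intro n _
    simp
  smul_mem' := by
    intro c f hf n hn
    rw [smul_eq_mul, Subalgebra.coe_mul, coeff_mul]
    refine Ideal.sum_mem _ ?_
    rintro ⟨i, j⟩ e
    have e' := Finset.HasAntidiagonal.mem_antidiagonal.mp e
    rw [← e']
    have h1 := Ideal.mul_mem_mul (c.2 i) (hf j (by simp only at e'; omega))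
    rw [mul_left_comm] at h1
    exact Ideal.mul_mono_right (F.mul_le i j) h1

lemma fiberIdeal_le_fiberTail (J : Ideal A) (k : ℕ) : F.fiberIdeal J ≤ F.fiberTail J k :=
  fun _ hf n _ => hf n

/-- Successive tails differ by exactly one degree of the fiber cone, read off by the k-th
coefficient. -/
lemma length_quotient_fiberTail (J : Ideal A) (k : ℕ) :
    Module.length A (F.rees ⧸ F.fiberTail J k) = ∑ n ∈ Finset.range k, F.hilbert J n := by
  rw [← (Submodule.Quotient.restrictScalarsEquiv A (F.fiberTail J k)).length_eq,
    ← Submodule.relLength_top]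
  induction k with
  | zero =>
    rw [Finset.range_zero, Finset.sum_empty, Submodule.relLength_eq_zero_iff]
    intro f _ n hn
    omega
  | succ k ih =>
    rw [Submodule.relLength_add (N := (F.fiberTail J k).restrictScalars A)
      (fun f (hf : f ∈ F.fiberTail J (k + 1)) n hn => hf n (by omega)) le_top, ih, Finset.sum_range_succ, add_comm]
    congr 1
    refine Submodule.relLength_eq_of_linearMap ((lcoeff A k).comp F.rees.val.toLinearMap)
      (fun f _ => f.2 k) (fun f hf => ⟨fun h n hn => ?_, fun h => h k (by omega)⟩)
      (fun a ha => ⟨F.reesMonomial ha, fun n hn => ?_, ?_⟩)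
    · rcases Nat.lt_succ_iff_lt_or_eq.1 hn with hn | rfl
      · exact hf n hn
      · exact h
    · rw [coe_reesMonomial, coeff_monomial, if_neg (by omega)]
      exact Ideal.zero_mem _
    · have : a - ((lcoeff A k).comp F.rees.val.toLinearMap) (F.reesMonomial ha) = 0 := by
        simp
      rw [this]
      exact Ideal.zero_mem _

end Rees

end IdealFiltration

/-! ### Lengths after localization at a maximal ideal. -/

section Localization

open IsLocalRing

variable {A S R : Type*} [CommRing A] [IsLocalRing A] [CommRing S] [CommRing R] [IsLocalRing R]
  [Algebra S R] (𝔑 : Ideal S) [h𝔑 : 𝔑.IsMaximal] [IsLocalization.AtPrime R 𝔑]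
  [Algebra A S] [Algebra A R] [IsScalarTower A S R]

/-- If `S = A + 𝔑` and `𝔑` lies over the maximal ideal of the local ring `A`, the Hilbert–Samuel
function of `S_𝔑` may be computed as the length of `S / 𝔑ⁿ` over `A`. -/
lemma IsLocalization.AtPrime.length_quotient_maximalIdeal_pow
    (h1 : ∀ s : S, ∃ a : A, s - algebraMap A S a ∈ 𝔑)
    (h2 : ∀ a ∈ maximalIdeal A, algebraMap A S a ∈ 𝔑) (n : ℕ) :
    Module.length R (R ⧸ maximalIdeal R ^ n) = Module.length A (S ⧸ 𝔑 ^ n) := by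
  have hmem (s : S) : algebraMap S R s ∈ maximalIdeal R ↔ s ∈ 𝔑 :=
    IsLocalization.AtPrime.to_map_mem_maximal_iff R 𝔑 s
  have hloc : IsLocalHom (algebraMap A R) := by
    refine ⟨fun a ha => ?_⟩
    by_contra hna
    have h3 := (hmem _).2 (h2 a ((mem_maximalIdeal a).2 hna))
    rw [← IsScalarTower.algebraMap_apply] at h3
    exact h3 ha
  rw [← IsLocalRing.length_eq_of_residue_surjective (A := A)]
  · exact ((IsLocalization.AtPrime.equivQuotMaximalIdealPow 𝔑 R n).toLinearEquiv.restrictScalars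
      A).length_eq.symm
  · intro r
    obtain ⟨s, hs⟩ := (IsLocalization.AtPrime.equivQuotMaximalIdeal 𝔑 R).surjective
      (Ideal.Quotient.mk _ r)
    obtain ⟨s, rfl⟩ := Ideal.Quotient.mk_surjective s
    rw [IsLocalization.AtPrime.equivQuotMaximalIdeal_apply_mk, eq_comm, Ideal.Quotient.eq] at hs
    obtain ⟨a, ha⟩ := h1 s
    refine ⟨a, ?_⟩
    have h3 := (hmem _).2 ha
    rw [map_sub, ← IsScalarTower.algebraMap_apply] at h3
    have := Ideal.add_mem _ hs h3
    rwa [sub_add_sub_cancel] at this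

end Localization

lemma IsLocalization.of_submonoid_eq {S R : Type*} [CommRing S] [CommRing R] [Algebra S R]
    {M N : Submonoid S} (h : M = N) [hM : IsLocalization M R] : IsLocalization N R := h ▸ hM

/-! ### The fiber cone localized at its maximal homogeneous ideal. -/

namespace IdealFiltration

section

variable {A : Type u} [CommRing A] (F : IdealFiltration A) (J : Ideal A)

lemma toFiberCone_surjective : Function.Surjective (F.toFiberCone J) :=
  Ideal.Quotient.mk_surjective

lemma ker_toFiberCone : RingHom.ker (F.toFiberCone J) = F.fiberIdeal J := Ideal.mk_ker

lemma isNoetherianRing_fiberCone [IsNoetherianRing A] {𝔟 : Ideal A} (h : F.IsReduction 𝔟) :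
    IsNoetherianRing (F.FiberCone J) := by
  have := h.isNoetherianRing_rees
  exact isNoetherianRing_of_surjective F.rees (F.FiberCone J) _ (F.toFiberCone_surjective J)

lemma isNoetherianRing_localFiberCone [IsNoetherianRing A] {𝔟 : Ideal A} (h : F.IsReduction 𝔟) :
    IsNoetherianRing (F.LocalFiberCone J) := by
  have := F.isNoetherianRing_fiberCone (J := J) h
  exact IsLocalization.isNoetherianRing (F.maxHomogeneousCompl.map (F.toFiberCone J)) _ this

/-- The projection of the Rees algebra onto the fiber cone, as a linear map. -/
noncomputable def toFiberConeLinear (B : Type v) [CommRing B] [Algebra B A] :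
    F.rees →ₗ[B] F.FiberCone J :=
  (Ideal.Quotient.mkₐ B (F.fiberIdeal J)).toLinearMap

lemma toFiberConeLinear_apply (B : Type v) [CommRing B] [Algebra B A] (f : F.rees) :
    F.toFiberConeLinear J B f = F.toFiberCone J f := rfl

end

section LocalFiberCone

open IsLocalRing

variable {A : Type u} [CommRing A] [IsLocalRing A] (F : IdealFiltration A) (J : Ideal A)

/-- The maximal homogeneous ideal `𝔪 ⊕ ⨁ₙ≥₁ Iₙ tⁿ` of the Rees algebra. -/
noncomputable def reesMaximal : Ideal F.rees :=
  (maximalIdeal A).comap ((constantCoeff (R := A)).comp F.rees.val.toRingHom)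

lemma mem_reesMaximal {f : F.rees} :
    f ∈ F.reesMaximal ↔ (f : A[X]).coeff 0 ∈ maximalIdeal A := Iff.rfl

instance : F.reesMaximal.IsMaximal := by
  refine Ideal.comap_isMaximal_of_surjective _ fun a => ⟨algebraMap A F.rees a, ?_⟩
  change (C a).coeff 0 = a
  simp

variable {J} in
lemma fiberIdeal_le_reesMaximal (hJ : J ≤ maximalIdeal A) : F.fiberIdeal J ≤ F.reesMaximal :=
  fun _ hf => hJ (Ideal.mul_le_left (hf 0))

/-- The maximal homogeneous ideal of the fiber cone. -/
noncomputable def fiberMaximal : Ideal (F.FiberCone J) := F.reesMaximal.map (F.toFiberCone J)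

variable {J}

lemma toFiberCone_mem_fiberMaximal (hJ : J ≤ maximalIdeal A) {f : F.rees} :
    F.toFiberCone J f ∈ F.fiberMaximal J ↔ f ∈ F.reesMaximal := by
  have h : (F.fiberMaximal J).comap (F.toFiberCone J) = F.reesMaximal := by
    rw [fiberMaximal, Ideal.comap_map_of_surjective' _ (F.toFiberCone_surjective J),
      ker_toFiberCone, sup_eq_left]
    exact F.fiberIdeal_le_reesMaximal hJ
  rw [← h, Ideal.mem_comap]

lemma fiberMaximal_isMaximal (hJ : J ≤ maximalIdeal A) : (F.fiberMaximal J).IsMaximal := by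
  refine (Ideal.map_eq_top_or_isMaximal_of_surjective _ (F.toFiberCone_surjective J)
    (I := F.reesMaximal) inferInstance).resolve_left fun h => ?_
  have h1 : F.toFiberCone J 1 ∈ F.fiberMaximal J := by
    rw [fiberMaximal, h]; trivial
  rw [F.toFiberCone_mem_fiberMaximal hJ] at h1
  exact (Ideal.ne_top_iff_one _).1 (Ideal.IsMaximal.ne_top inferInstance) h1

lemma map_maxHomogeneousCompl (hJ : J ≤ maximalIdeal A) [(F.fiberMaximal J).IsPrime] :
    F.maxHomogeneousCompl.map (F.toFiberCone J) = (F.fiberMaximal J).primeCompl := by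
  ext z
  obtain ⟨f, rfl⟩ := F.toFiberCone_surjective J z
  have key (g : F.rees) : g ∈ F.maxHomogeneousCompl ↔
      F.toFiberCone J g ∈ (F.fiberMaximal J).primeCompl := by
    rw [Ideal.mem_primeCompl_iff, F.toFiberCone_mem_fiberMaximal hJ, mem_reesMaximal,
      IsLocalRing.notMem_maximalIdeal]
    rfl
  rw [← key]
  constructor
  · rintro ⟨g, hg, h⟩
    rw [key, ← h]
    exact (key g).1 hg
  · exact fun h => ⟨f, h, rfl⟩

lemma localFiberCone_isLocalization (hJ : J ≤ maximalIdeal A) [(F.fiberMaximal J).IsPrime] :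
    IsLocalization.AtPrime (F.LocalFiberCone J) (F.fiberMaximal J) :=
  IsLocalization.of_submonoid_eq (F.map_maxHomogeneousCompl hJ)

lemma localFiberCone_isLocalRing (hJ : J ≤ maximalIdeal A) : IsLocalRing (F.LocalFiberCone J) := by
  have := F.fiberMaximal_isMaximal hJ
  have := F.localFiberCone_isLocalization hJ
  exact IsLocalization.AtPrime.isLocalRing _ (F.fiberMaximal J)

/-- The localization has the same residue field as A, so its Hilbert–Samuel function can be computed
over A in the Rees algebra, where degrees are visible. -/
lemma length_localFiberCone (hJ : J ≤ maximalIdeal A) [IsLocalRing (F.LocalFiberCone J)] (n : ℕ) :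
    Module.length (F.LocalFiberCone J)
      (F.LocalFiberCone J ⧸ maximalIdeal (F.LocalFiberCone J) ^ n) =
    Module.length A (F.rees ⧸ (F.reesMaximal ^ n ⊔ F.fiberIdeal J)) := by
  have := F.fiberMaximal_isMaximal hJ
  have := F.localFiberCone_isLocalization hJ
  rw [IsLocalization.AtPrime.length_quotient_maximalIdeal_pow (A := A) (F.fiberMaximal J)]
  · rw [← (Submodule.Quotient.restrictScalarsEquiv A (F.fiberMaximal J ^ n)).length_eq,
      ← (Submodule.Quotient.restrictScalarsEquiv A
        (F.reesMaximal ^ n ⊔ F.fiberIdeal J)).length_eq,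
      ← Submodule.relLength_top, ← Submodule.relLength_top]
    symm
    have hc : (F.fiberMaximal J ^ n).comap (F.toFiberCone J) =
        F.reesMaximal ^ n ⊔ F.fiberIdeal J := by
      rw [fiberMaximal, ← Ideal.map_pow,
        Ideal.comap_map_of_surjective' _ (F.toFiberCone_surjective J), ker_toFiberCone]
    refine Submodule.relLength_eq_of_linearMap
      (F.toFiberConeLinear J A) (fun _ _ => trivial)
      (fun f _ => ?_) (fun z _ => ?_)
    · change F.toFiberCone J f ∈ F.fiberMaximal J ^ n ↔ f ∈ F.reesMaximal ^ n ⊔ F.fiberIdeal J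
      rw [← hc, Ideal.mem_comap]
    · obtain ⟨f, hf⟩ := F.toFiberCone_surjective J z
      refine ⟨f, trivial, ?_⟩
      rw [toFiberConeLinear_apply, hf, sub_self]
      exact Submodule.zero_mem _
  · intro z
    obtain ⟨f, rfl⟩ := F.toFiberCone_surjective J z
    refine ⟨(f : A[X]).coeff 0, ?_⟩
    change F.toFiberCone J (f - algebraMap A F.rees _) ∈ _
    rw [F.toFiberCone_mem_fiberMaximal hJ, mem_reesMaximal]
    change ((f : A[X]) - C _).coeff 0 ∈ _
    simp
  · intro a ha
    change F.toFiberCone J (algebraMap A F.rees a) ∈ _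
    rw [F.toFiberCone_mem_fiberMaximal hJ, mem_reesMaximal]
    change (C a).coeff 0 ∈ _
    simpa using ha

/-- Each factor contributes an element of 𝔪 or a positive degree. In degree k at most k factors do
the latter, leaving at least n - k in 𝔪. -/
lemma reesMaximal_pow_coeff {f : F.rees} (n : ℕ) (hf : f ∈ F.reesMaximal ^ n) (k : ℕ) :
    (f : A[X]).coeff k ∈ maximalIdeal A ^ (n - k) * F.ideal k := by
  induction n generalizing f k with
  | zero => simpa using f.2 k
  | succ n ih =>
    rw [pow_succ'] at hf
    refine Submodule.mul_induction_on hf (fun g hg h hh => ?_) (fun g h hg hh => ?_)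
    · rw [Subalgebra.coe_mul, coeff_mul]
      refine Ideal.sum_mem _ ?_
      rintro ⟨i, j⟩ e
      have e' := Finset.HasAntidiagonal.mem_antidiagonal.mp e
      subst e'
      rcases i with _ | i
      · have h1 := Ideal.mul_mem_mul (F.mem_reesMaximal.1 hg) (ih hh j)
        rw [← mul_assoc, ← pow_succ'] at h1
        refine Ideal.mul_mono_left (Ideal.pow_le_pow_right ?_) ?_ (I := maximalIdeal A ^ (n - j + 1))
        · simp only; omega
        · simpa using h1
      · have h1 := Ideal.mul_mem_mul (g.2 (i + 1)) (ih hh j)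
        rw [mul_left_comm] at h1
        refine Ideal.mul_mono (Ideal.pow_le_pow_right ?_) (F.mul_le _ _) h1
        simp only; omega
    · simpa using Ideal.add_mem _ hg hh

variable {F}

lemma reesMaximal_pow_le_fiberTail {c : ℕ} (hc : maximalIdeal A ^ c ≤ J) (n : ℕ) :
    F.reesMaximal ^ n ≤ F.fiberTail J (n - c) := fun _ hf k hk =>
  Ideal.mul_mono_left ((Ideal.pow_le_pow_right (by omega)).trans hc)
    (F.reesMaximal_pow_coeff n hf k)

/-- From degree n + N on, Iₖ = 𝔟ⁿ Iₖ₋ₙ, and 𝔟t lies in the maximal homogeneous ideal. -/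
lemma IsReduction.exists_fiberTail_le {𝔟 : Ideal A} (h : F.IsReduction 𝔟) :
    ∃ N, ∀ n, F.fiberTail J (n + N) ≤ F.reesMaximal ^ n ⊔ F.fiberIdeal J := by
  obtain ⟨N, hN⟩ := h.exists_pow
  have h1 : 𝔟 ≤ degreePart F.reesMaximal 1 := fun b hb =>
    ⟨F.reesMonomial (h.le_ideal_one hb), by
      rw [mem_reesMaximal, coe_reesMonomial, coeff_monomial]; simp, rfl⟩
  refine ⟨N, fun n f hf => mem_of_forall_coeff_mem fun k => ?_⟩
  by_cases hk : k < n + N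
  · exact degreePart_mono le_sup_right _ (mul_ideal_le_degreePart_fiberIdeal J k (hf k hk))
  · refine degreePart_mono le_sup_left _ ?_
    have h2 := f.2 k
    rw [hN n k (by omega)] at h2
    have h3 := (Ideal.mul_mono_left ((Ideal.pow_right_mono h1 n).trans (degreePart_pow _ n))).trans
      (degreePart_mul_ideal_le _ _ _) h2
    rwa [Nat.add_sub_cancel' (by omega)] at h3

lemma length_localFiberCone_ge (hJ : J ≤ maximalIdeal A) [IsLocalRing (F.LocalFiberCone J)] {c : ℕ}
    (hc : maximalIdeal A ^ c ≤ J) (n : ℕ) :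
    ∑ k ∈ Finset.range (n - c), F.hilbert J k ≤ Module.length (F.LocalFiberCone J)
      (F.LocalFiberCone J ⧸ maximalIdeal (F.LocalFiberCone J) ^ n) := by
  rw [F.length_localFiberCone hJ, ← length_quotient_fiberTail]
  exact Module.length_quotient_anti
    (sup_le (reesMaximal_pow_le_fiberTail hc n) (F.fiberIdeal_le_fiberTail J _))

lemma IsReduction.exists_length_localFiberCone_le {𝔟 : Ideal A} (h : F.IsReduction 𝔟)
    (hJ : J ≤ maximalIdeal A) [IsLocalRing (F.LocalFiberCone J)] :
    ∃ N, ∀ n, Module.length (F.LocalFiberCone J)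
      (F.LocalFiberCone J ⧸ maximalIdeal (F.LocalFiberCone J) ^ n) ≤
      ∑ k ∈ Finset.range (n + N), F.hilbert J k := by
  obtain ⟨N, hN⟩ := h.exists_fiberTail_le (J := J)
  refine ⟨N, fun n => ?_⟩
  rw [F.length_localFiberCone hJ, ← length_quotient_fiberTail]
  exact Module.length_quotient_anti (hN n)

end LocalFiberCone

end IdealFiltration

/-! ### Growth of the Hilbert function, dimension and multiplicity. -/

namespace IdealFiltration

open IsLocalRing

variable {A : Type u} [CommRing A] [IsLocalRing A] [IsNoetherianRing A] {F : IdealFiltration A}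
  {J : Ideal A}

/-- Links F_J(F) to F_𝔪(F), the only cone whose dimension is given: Iₙ has l(Iₙ/𝔪Iₙ) generators,
each contributing at most l(A/J). -/
lemma hilbert_le_hilbert_maximalIdeal_mul (n : ℕ) :
    F.hilbert J n ≤ F.hilbert (maximalIdeal A) n * Module.length A (A ⧸ J) := by
  have hfg : (F.ideal n).FG := IsNoetherian.noetherian _
  have h := Submodule.relLength_smul_le J (F.ideal n) hfg
  rwa [Submodule.spanFinrank_eq_relLength_maximalIdeal _ hfg] at h

lemma hilbert_ne_top {c : ℕ} (hc : maximalIdeal A ^ c ≤ J) (n : ℕ) : F.hilbert J n ≠ ⊤ :=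
  ne_top_of_le_ne_top (WithTop.mul_ne_top (ENat.natCast_ne_top _) (length_quotient_ne_top hc))
    (Submodule.relLength_smul_le J (F.ideal n) (IsNoetherian.noetherian _))

lemma sum_hilbert_eq_coe {c : ℕ} (hc : maximalIdeal A ^ c ≤ J) (n : ℕ) :
    ∑ k ∈ Finset.range n, F.hilbert J k =
      ((∑ k ∈ Finset.range n, (F.hilbert J k).toNat : ℕ) : ℕ∞) := by
  rw [Nat.cast_sum]
  exact Finset.sum_congr rfl fun k _ => (ENat.natCast_toNat (hilbert_ne_top hc k)).symm

/-- The sum of the first values of the Hilbert function of a fiber cone of dimension at most `l`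
grows at most like `n ^ l`. -/
lemma IsReduction.exists_sum_hilbert_le {𝔟 : Ideal A} (h : F.IsReduction 𝔟)
    (hJ : J ≤ maximalIdeal A) {c : ℕ} (hc : maximalIdeal A ^ c ≤ J) {l : ℕ}
    (hl : ringKrullDim (F.FiberCone J) ≤ l) :
    ∃ C : ℕ, ∀ n, ∑ k ∈ Finset.range n, F.hilbert J k ≤ (C * (n + c + 1) ^ l : ℕ) := by
  have := F.localFiberCone_isLocalRing hJ
  have := F.isNoetherianRing_localFiberCone (J := J) h
  have := F.fiberMaximal_isMaximal hJ
  have := F.localFiberCone_isLocalization hJ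
  have hdim : ringKrullDim (F.LocalFiberCone J) ≤ l := by
    rw [IsLocalization.AtPrime.ringKrullDim_eq_height (F.fiberMaximal J)]
    exact Ideal.height_le_ringKrullDim_of_isPrime.trans hl
  obtain ⟨d, hd⟩ : ∃ d : ℕ, ringKrullDim (F.LocalFiberCone J) = d := by
    rw [← maximalIdeal_height_eq_ringKrullDim] at hdim ⊢
    have h1 : (maximalIdeal (F.LocalFiberCone J)).height ≤ l := by exact_mod_cast hdim
    obtain ⟨d, hd⟩ := ENat.ne_top_iff_exists.1 (ne_top_of_le_ne_top (ENat.natCast_ne_top l) h1)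
    exact ⟨d, by rw [← hd]; rfl⟩
  have hdl : d ≤ l := by
    rw [hd] at hdim
    exact_mod_cast hdim
  obtain ⟨C, hC⟩ := exists_length_quotient_pow_le hd
  refine ⟨C, fun n => ?_⟩
  -- Evaluation at n + c undoes the shift by c in the lower bound.
  have h1 := (length_localFiberCone_ge hJ hc (n + c)).trans (hC (n + c))
  rw [Nat.add_sub_cancel] at h1
  refine h1.trans ?_
  have h2 : (n + c) ^ d ≤ (n + c + 1) ^ l :=
    (Nat.pow_le_pow_left (by omega) d).trans (Nat.pow_le_pow_right (by omega) hdl)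
  exact_mod_cast Nat.mul_le_mul_left C h2

/-- A reduction with `d` generators bounds the dimension of the fiber cone by `d`. -/
lemma ringKrullDim_localFiberCone_le (hJ : J ≤ maximalIdeal A) {c : ℕ}
    (hc : maximalIdeal A ^ c ≤ J) (t : Finset A) (ht : F.IsReduction (Ideal.span (t : Set A))) :
    ringKrullDim (F.LocalFiberCone J) ≤ t.card := by
  classical
  have := F.localFiberCone_isLocalRing hJ
  have := F.isNoetherianRing_localFiberCone (J := J) ht
  have := F.fiberMaximal_isMaximal hJ
  have := F.localFiberCone_isLocalization hJ
  have ht1 (a : t) : (a : A) ∈ F.ideal 1 := ht.le_ideal_one (Ideal.subset_span a.2)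
  set T : Finset F.rees := t.attach.image (fun a => F.reesMonomial (ht1 a)) with hT
  set φ : F.rees →+* F.LocalFiberCone J :=
    (algebraMap (F.FiberCone J) (F.LocalFiberCone J)).comp (F.toFiberCone J) with hφ
  have hmax : maximalIdeal (F.LocalFiberCone J) = F.reesMaximal.map φ := by
    rw [← IsLocalization.AtPrime.map_eq_maximalIdeal (F.fiberMaximal J), fiberMaximal,
      Ideal.map_map]
  obtain ⟨N, hN⟩ := ht.2
  -- The extra c puts coefficients of degree at most N into J Iₖ; from degree N + 1 on they lie in
  -- (t) Iₖ₋₁.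
  have h1 : F.reesMaximal ^ (N + 1 + c) ≤ Ideal.span (T : Set F.rees) ⊔ F.fiberIdeal J := by
    refine (reesMaximal_pow_le_fiberTail hc _).trans fun f hf =>
      mem_of_forall_coeff_mem fun k => ?_
    rw [Nat.add_sub_cancel] at hf
    by_cases hk : k < N + 1
    · exact degreePart_mono le_sup_right _ (mul_ideal_le_degreePart_fiberIdeal J k (hf k hk))
    · obtain ⟨k, rfl⟩ : ∃ k', k = k' + 1 := ⟨k - 1, by omega⟩
      have h2 := f.2 (k + 1)
      rw [hN k (by omega)] at h2
      have h3 : Ideal.span (t : Set A) ≤ degreePart (Ideal.span (T : Set F.rees)) 1 := by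
        rw [Ideal.span_le]
        intro a ha
        exact ⟨F.reesMonomial (ht1 ⟨a, ha⟩), Ideal.subset_span
          (Finset.mem_image.2 ⟨⟨a, ha⟩, Finset.mem_attach _ _, rfl⟩), rfl⟩
      have h4 := ((Ideal.mul_mono_left h3).trans (degreePart_mul_ideal_le _ _ _)) h2
      rw [add_comm 1 k] at h4
      exact degreePart_mono le_sup_left _ h4
  have h2 : maximalIdeal (F.LocalFiberCone J) ^ (N + 1 + c) ≤
      Ideal.span ((T.image φ : Finset _) : Set (F.LocalFiberCone J)) := by
    rw [hmax, ← Ideal.map_pow]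
    refine (Ideal.map_mono h1).trans ?_
    rw [Ideal.map_sup, Ideal.map_span]
    refine sup_le (le_of_eq (congrArg Ideal.span Finset.coe_image.symm)) ?_
    rw [Ideal.map_le_iff_le_comap]
    intro f hf
    rw [Ideal.mem_comap]
    have h0 : F.toFiberCone J f = 0 := by
      rwa [← RingHom.mem_ker, ker_toFiberCone]
    have : φ f = 0 := by
      rw [hφ, RingHom.comp_apply, h0, map_zero]
    rw [this]
    exact Ideal.zero_mem _
  have h3 : ((T.image φ : Finset _) : Set (F.LocalFiberCone J)) ⊆
      maximalIdeal (F.LocalFiberCone J) := by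
    rw [hmax, Finset.coe_image]
    rintro _ ⟨f, hf, rfl⟩
    obtain ⟨a, _, rfl⟩ := Finset.mem_image.1 hf
    refine Ideal.mem_map_of_mem _ ?_
    rw [mem_reesMaximal, coe_reesMonomial, coeff_monomial]
    simp
  refine (ringKrullDim_le_card_of_pow_le _ h3 h2).trans ?_
  have h4 : (T.image φ).card ≤ t.card :=
    Finset.card_image_le.trans (Finset.card_image_le.trans_eq Finset.card_attach)
  exact_mod_cast h4

/-- The multiplicity of the fiber cone is read off from the leading term of its Hilbert
function. -/
lemma hasFiberMultiplicity_of_tendsto (hJ : J ≤ maximalIdeal A) {c : ℕ}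
    (hc : maximalIdeal A ^ c ≤ J) {t : Finset A} (ht : F.IsReduction (Ideal.span (t : Set A)))
    {j : ℕ} (hj : t.card ≤ j + 1) {e : ℝ} (he : 0 < e)
    (h : Tendsto (fun n : ℕ => ((F.hilbert J n).toNat : ℝ) / (n : ℝ) ^ j) atTop
      (𝓝 (e / (Nat.factorial j : ℝ)))) :
    F.HasFiberMultiplicity J e := by
  have hloc := F.localFiberCone_isLocalRing hJ
  have hnoeth := F.isNoetherianRing_localFiberCone (J := J) ht
  set L : ℕ → ℕ := fun n => (Module.length (F.LocalFiberCone J)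
      (F.LocalFiberCone J ⧸ maximalIdeal (F.LocalFiberCone J) ^ n)).toNat with hL
  set S : ℕ → ℕ := fun n => ∑ k ∈ Finset.range n, (F.hilbert J k).toNat with hS
  obtain ⟨N, hN⟩ := ht.exists_length_localFiberCone_le (J := J) hJ
  have hup (n : ℕ) : L n ≤ S (n + N) := by
    refine ENat.toNat_le_of_le_natCast ((hN n).trans_eq (sum_hilbert_eq_coe hc _))
  have hfin (n : ℕ) : (L n : ℕ∞) = Module.length (F.LocalFiberCone J)
      (F.LocalFiberCone J ⧸ maximalIdeal (F.LocalFiberCone J) ^ n) := by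
    refine ENat.natCast_toNat (ne_top_of_le_ne_top ?_ (hN n))
    rw [sum_hilbert_eq_coe hc]
    exact ENat.natCast_ne_top _
  have hlow (n : ℕ) : S (n - c) ≤ L n := by
    have h1 := length_localFiberCone_ge (F := F) hJ hc n
    rw [sum_hilbert_eq_coe hc, ← hfin] at h1
    exact_mod_cast h1
  have hSlim : Tendsto (fun n : ℕ => (S n : ℝ) / (n : ℝ) ^ (j + 1)) atTop
      (𝓝 (e / (Nat.factorial (j + 1) : ℝ))) := by
    have h1 := tendsto_sum_range_div_pow h
    have h2 : e / (Nat.factorial j : ℝ) / (j + 1) = e / (Nat.factorial (j + 1) : ℝ) := by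
      rw [div_div, Nat.factorial_succ]
      push_cast
      rw [mul_comm ((j : ℝ) + 1)]
    rw [h2] at h1
    refine h1.congr fun n => ?_
    simp [hS]
  have hLlim : Tendsto (fun n : ℕ => (L n : ℝ) / (n : ℝ) ^ (j + 1)) atTop
      (𝓝 (e / (Nat.factorial (j + 1) : ℝ))) := by
    refine tendsto_of_tendsto_of_tendsto_of_le_of_le
      (tendsto_shift_sub_div_pow (f := fun n => (S n : ℝ)) c hSlim)
      (tendsto_shift_div_pow (f := fun n => (S n : ℝ)) N hSlim) (fun n => ?_) (fun n => ?_)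
    · have := hlow n
      dsimp only
      gcongr
    · have := hup n
      dsimp only
      gcongr
  have hfac : (0 : ℝ) < Nat.factorial (j + 1) := by exact_mod_cast Nat.factorial_pos _
  have hle := (ringKrullDim_localFiberCone_le hJ hc t ht).trans
    (show ((t.card : ℕ) : WithBot ℕ∞) ≤ ((j + 1 : ℕ) : WithBot ℕ∞) by exact_mod_cast hj)
  obtain ⟨d, hd⟩ : ∃ d : ℕ, ringKrullDim (F.LocalFiberCone J) = d := by
    rw [← maximalIdeal_height_eq_ringKrullDim] at hle ⊢
    have h1 : (maximalIdeal (F.LocalFiberCone J)).height ≤ (j + 1 : ℕ) := by exact_mod_cast hle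
    obtain ⟨d, hd⟩ := ENat.ne_top_iff_exists.1 (ne_top_of_le_ne_top (ENat.natCast_ne_top _) h1)
    exact ⟨d, by rw [← hd]; rfl⟩
  have hdj : d ≤ j + 1 := by
    rw [hd] at hle
    exact_mod_cast hle
  -- A smaller dimension would make the Hilbert–Samuel function O(n^j), against its positive leading
  -- coefficient in degree j + 1.
  have hdj' : d = j + 1 := by
    by_contra hne
    have hlt : d ≤ j := by omega
    obtain ⟨C, hC⟩ := exists_length_quotient_pow_le hd
    have h1 (n : ℕ) : L n ≤ C * n ^ d := by
      have := hC n
      rw [← hfin] at this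
      exact_mod_cast this
    have h2 : Tendsto (fun n : ℕ => (C : ℝ) / n) atTop (𝓝 0) :=
      tendsto_const_div_atTop_nhds_zero_nat _
    have h3 : e / (Nat.factorial (j + 1) : ℝ) ≤ 0 := by
      refine le_of_tendsto_of_tendsto hLlim h2 ?_
      filter_upwards [eventually_gt_atTop 0] with n hn
      have hn' : (0 : ℝ) < n := by exact_mod_cast hn
      rw [div_le_div_iff₀ (by positivity) hn']
      have h4 : (L n : ℝ) ≤ C * (n : ℝ) ^ j := by
        have h5 : L n ≤ C * n ^ j := (h1 n).trans
          (Nat.mul_le_mul_left C (Nat.pow_le_pow_right hn hlt))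
        exact_mod_cast h5
      calc (L n : ℝ) * n ≤ C * (n : ℝ) ^ j * n := by gcongr
        _ = C * (n : ℝ) ^ (j + 1) := by ring
    exact absurd h3 (not_le.2 (by positivity))
  refine ⟨hnoeth, hloc, j + 1, hdj' ▸ hd, ?_⟩
  have h1 := hLlim.const_mul (Nat.factorial (j + 1) : ℝ)
  rw [mul_div_cancel₀ _ hfac.ne'] at h1
  exact h1.congr fun n => (mul_div_assoc _ _ _).symm

end IdealFiltration

/-! ### Partial sequences and saturations. -/

section InitialIdeal

variable {A : Type u} [CommRing A] {s : ℕ} (x : Fin s → A)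

lemma initialIdeal_zero : initialIdeal x 0 = ⊥ := by
  simp [initialIdeal]

lemma initialIdeal_succ (i : Fin s) :
    initialIdeal x (i + 1) = initialIdeal x i ⊔ Ideal.span {x i} := by
  rw [initialIdeal, initialIdeal, ← Ideal.span_union]
  congr 1
  ext a
  constructor
  · rintro ⟨j, hj, rfl⟩
    rcases Nat.lt_succ_iff_lt_or_eq.1 hj with hj | hj
    · exact Or.inl ⟨j, hj, rfl⟩
    · exact Or.inr (by rw [Fin.ext hj]; rfl)
  · rintro (⟨j, hj, rfl⟩ | rfl)
    · exact ⟨j, by omega, rfl⟩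
    · exact ⟨i, by omega, rfl⟩

lemma initialIdeal_eq_span_range : initialIdeal x s = Ideal.span (Set.range x) := by
  rw [initialIdeal]
  congr 1
  ext a
  exact ⟨fun ⟨j, _, h⟩ => ⟨j, h⟩, fun ⟨j, h⟩ => ⟨j, j.2, h⟩⟩

lemma le_idealSaturation (Q I : Ideal A) : Q ≤ idealSaturation Q I :=
  fun _ ha => ⟨0, fun b _ => Q.mul_mem_right b ha⟩

/-- In a Noetherian ring a single power of `I` multiplies `Q : I^∞` into `Q`. -/
lemma exists_idealSaturation_mul_pow_le [IsNoetherianRing A] (Q I : Ideal A) :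
    ∃ k, idealSaturation Q I * I ^ k ≤ Q := by
  obtain ⟨t, ht⟩ := (IsNoetherian.noetherian (idealSaturation Q I) : (idealSaturation Q I).FG)
  have h1 (a : t) : ∃ k : ℕ, ∀ b ∈ I ^ k, (a : A) * b ∈ Q :=
    ht.le (Submodule.subset_span a.2)
  choose k hk using h1
  refine ⟨t.attach.sup k, ?_⟩
  rw [Ideal.mul_le]
  intro a ha b hb
  have h2 : Ideal.span (t : Set A) ≤ Submodule.comap (LinearMap.mulRight A b) Q := by
    rw [Ideal.span_le]
    intro a ha
    exact hk ⟨a, ha⟩ b (Ideal.pow_le_pow_right (Finset.le_sup (Finset.mem_attach t ⟨a, ha⟩)) hb)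
  exact h2 (ht.symm.le ha)

end InitialIdeal

/-! ### Hilbert functions modulo an ideal, and the recursion for weak-(FC)-elements. -/

namespace IdealFiltration

open IsLocalRing

section HilbertMod

variable {A : Type u} [CommRing A] (F : IdealFiltration A) (J : Ideal A)

/-- The Hilbert function `n ↦ l((Iₙ + Q) / (J Iₙ + Q))` of the fiber cone of `F/Q`. -/
noncomputable def hilbertMod (Q : Ideal A) (n : ℕ) : ℕ∞ :=
  Submodule.relLength (J * F.ideal n ⊔ Q) (F.ideal n ⊔ Q)

lemma hilbertMod_bot (n : ℕ) : F.hilbertMod J ⊥ n = F.hilbert J n := by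
  rw [hilbertMod, hilbert, sup_bot_eq, sup_bot_eq]

lemma hilbert_quotient (Q : Ideal A) (n : ℕ) :
    (F.quotient Q).hilbert (J.map (Ideal.Quotient.mk Q)) n = F.hilbertMod J Q n := by
  rw [hilbert, ← Submodule.relLength_restrictScalars (B := A) Ideal.Quotient.mk_surjective]
  symm
  refine Submodule.relLength_eq_of_linearMap (Submodule.mkQ Q)
    (fun a ha => Ideal.mem_quotient_iff_mem_sup.2 ha) (fun a _ => ?_) (fun b hb => ?_)
  · change Ideal.Quotient.mk Q a ∈ J.map (Ideal.Quotient.mk Q) *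
      (F.ideal n).map (Ideal.Quotient.mk Q) ↔ _
    rw [← Ideal.map_mul, Ideal.mem_quotient_iff_mem_sup]
  · obtain ⟨b, rfl⟩ := Submodule.mkQ_surjective _ b
    exact ⟨b, Ideal.mem_quotient_iff_mem_sup.1 hb, by simp⟩

variable {F J}

/-- Under this hypothesis passing from Q to P loses nothing in degree n; Artin–Rees supplies it for
the saturation when n is large. -/
lemma hilbertMod_eq_of_inf_le {Q P : Ideal A} (hQP : Q ≤ P) {n : ℕ}
    (h : (F.ideal n ⊔ Q) ⊓ P ≤ Q) : F.hilbertMod J P n = F.hilbertMod J Q n := by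
  symm
  refine Submodule.relLength_eq_of_linearMap LinearMap.id
    (fun a ha => sup_le_sup_left hQP _ ha) (fun a ha => ⟨fun h1 => ?_, fun h1 => ?_⟩)
    (fun b hb => ?_)
  · obtain ⟨b, hb, p, hp, h2⟩ := Submodule.mem_sup.1 h1
    rw [LinearMap.id_apply] at h2
    rw [← h2]
    refine Submodule.add_mem_sup hb (h ⟨?_, hp⟩)
    rw [← add_sub_cancel_left b p, h2]
    exact Ideal.sub_mem _ ha (Submodule.mem_sup_left (Ideal.mul_le_right (I := J) hb))
  · exact sup_le_sup_left hQP _ h1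
  · obtain ⟨a, ha, p, hp, rfl⟩ := Submodule.mem_sup.1 hb
    exact ⟨a, Submodule.mem_sup_left ha, Submodule.mem_sup_right (by simpa using hp)⟩

/-- By the Artin–Rees lemma, `Iₙ (A/Q)` meets `(Q : I₁^∞) / Q` trivially for large `n`. -/
lemma IsReduction.exists_sup_inf_idealSaturation_le [IsNoetherianRing A] {𝔟 : Ideal A}
    (h : F.IsReduction 𝔟) (Q : Ideal A) :
    ∃ N, ∀ n, N ≤ n → (F.ideal n ⊔ Q) ⊓ idealSaturation Q (F.ideal 1) ≤ Q := by
  obtain ⟨s, hs⟩ := exists_idealSaturation_mul_pow_le Q (F.ideal 1)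
  obtain ⟨N, hN⟩ := h.exists_pow
  set P := idealSaturation Q (F.ideal 1)
  set φ := Ideal.Quotient.mk Q
  obtain ⟨k, hk⟩ := Ideal.exists_pow_inf_eq_pow_smul (𝔟.map φ) (P.map φ)
  -- N makes Iₙ ⊆ 𝔟^(k+s), k is the Artin–Rees constant, and the s remaining factors of 𝔟 carry P
  -- into Q.
  refine ⟨N + (k + s), fun n hn a ha => ?_⟩
  have h1 : φ a ∈ (𝔟.map φ) ^ (k + s) • (⊤ : Submodule (A ⧸ Q) (A ⧸ Q)) ⊓ P.map φ := by
    refine ⟨?_, Ideal.mem_map_of_mem _ ha.2⟩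
    rw [smul_eq_mul, Ideal.mul_top, ← Ideal.map_pow]
    refine Ideal.mem_quotient_iff_mem_sup.2 ?_
    have h0 : F.ideal n ≤ 𝔟 ^ (k + s) := by
      rw [hN (k + s) n hn]
      exact Ideal.mul_le_left
    exact (sup_le_sup_right h0 Q : _) ha.1
  rw [hk (k + s) (by omega), Nat.add_sub_cancel_left] at h1
  have h2 : (𝔟.map φ) ^ s • ((𝔟.map φ) ^ k • (⊤ : Submodule (A ⧸ Q) (A ⧸ Q)) ⊓ P.map φ) ≤
      (𝔟 ^ s * P).map φ := by
    rw [Ideal.map_mul, Ideal.map_pow, smul_eq_mul]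
    exact Ideal.mul_mono_right inf_le_right
  have h3 := Ideal.mem_quotient_iff_mem_sup.1 (h2 h1)
  have h4 : 𝔟 ^ s * P ≤ Q := by
    rw [mul_comm]
    exact (Ideal.mul_mono_right (Ideal.pow_right_mono h.le_ideal_one s)).trans hs
  exact (sup_le h4 le_rfl : _ ≤ Q) h3

/-- Nakayama. It translates nilpotency of F/Q into vanishing of the Hilbert function. -/
lemma hilbertMod_eq_zero_iff [IsLocalRing A] [IsNoetherianRing A] (hJ : J ≤ maximalIdeal A)
    {Q : Ideal A} {n : ℕ} : F.hilbertMod J Q n = 0 ↔ F.ideal n ≤ Q := by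
  rw [hilbertMod, Submodule.relLength_eq_zero_iff]
  constructor
  · intro h
    refine Submodule.le_of_le_smul_of_le_jacobson_bot (I := J) (IsNoetherian.noetherian _)
      (hJ.trans (IsLocalRing.jacobson_eq_maximalIdeal ⊥ bot_ne_top).ge) ?_
    rw [sup_comm, smul_eq_mul]
    exact le_sup_left.trans h
  · intro h
    exact sup_le (h.trans le_sup_right) le_sup_right

lemma hilbertMod_ne_top [IsLocalRing A] [IsNoetherianRing A] {c : ℕ}
    (hc : maximalIdeal A ^ c ≤ J) (Q : Ideal A) (n : ℕ) : F.hilbertMod J Q n ≠ ⊤ := by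
  refine ne_top_of_le_ne_top (hilbert_ne_top (F := F) hc n) ?_
  refine Submodule.relLength_le_of_surjective LinearMap.id
    (fun a ha => Submodule.mem_sup_left ha) (fun a ha _ => Submodule.mem_sup_left ha)
    (fun b hb => ?_)
  obtain ⟨a, ha, p, hp, rfl⟩ := Submodule.mem_sup.1 hb
  exact ⟨a, ha, Submodule.mem_sup_right (by simpa using hp)⟩

end HilbertMod

section WeakFC

variable {A : Type u} [CommRing A] {F : IdealFiltration A} {J Q : Ideal A} {x : A}

/-- Condition (FC₁) for `A/Q`, pulled back to `A`. -/
lemma IsWeakFCElement.exists_inf_le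
    (h : (F.quotient Q).IsWeakFCElement (J.map (Ideal.Quotient.mk Q)) (Ideal.Quotient.mk Q x)) :
    ∃ N, ∀ n, N ≤ n →
      (F.ideal (n + 1) ⊔ Q) ⊓ (Ideal.span {x} ⊔ Q) ≤ Ideal.span {x} * F.ideal n ⊔ Q ∧
      (J * F.ideal (n + 1) ⊔ Q) ⊓ (Ideal.span {x} ⊔ Q) ≤
        J * (Ideal.span {x} * F.ideal n) ⊔ Q := by
  obtain ⟨N, hN⟩ := h.fc1
  have hx : Ideal.span {Ideal.Quotient.mk Q x} = (Ideal.span {x}).map (Ideal.Quotient.mk Q) := by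
    rw [Ideal.map_span, Set.image_singleton]
  refine ⟨N, fun n hn => ⟨fun a ha => ?_, fun a ha => ?_⟩⟩
  -- Exponent m = 0 here and m = 1 in the second half; no other exponents are needed.
  · have h1 := hN n hn 0
    rw [pow_zero, one_mul, one_mul, hx] at h1
    have h2 : Ideal.Quotient.mk Q a ∈ (F.quotient Q).ideal (n + 1) ⊓
        (Ideal.span {x}).map (Ideal.Quotient.mk Q) :=
      ⟨Ideal.mem_quotient_iff_mem_sup.2 ha.1, Ideal.mem_quotient_iff_mem_sup.2 ha.2⟩
    rw [h1] at h2
    change _ ∈ _ * (F.ideal n).map _ at h2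
    rwa [← Ideal.map_mul, Ideal.mem_quotient_iff_mem_sup] at h2
  · have h1 := hN n hn 1
    rw [pow_one, hx] at h1
    have h2 : Ideal.Quotient.mk Q a ∈ J.map (Ideal.Quotient.mk Q) *
        (F.ideal (n + 1)).map (Ideal.Quotient.mk Q) ⊓
        (Ideal.span {x}).map (Ideal.Quotient.mk Q) := by
      rw [← Ideal.map_mul]
      exact ⟨Ideal.mem_quotient_iff_mem_sup.2 ha.1, Ideal.mem_quotient_iff_mem_sup.2 ha.2⟩
    change _ ∈ _ * (F.quotient Q).ideal (n + 1) ⊓ _ at h2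
    rw [h1] at h2
    change _ ∈ _ * (_ * (F.ideal n).map _) at h2
    rwa [← Ideal.map_mul, ← Ideal.map_mul, Ideal.mem_quotient_iff_mem_sup] at h2

/-- Condition (FC₂) for `A/Q`, pulled back to `A`. -/
lemma IsWeakFCElement.mem_idealSaturation
    (h : (F.quotient Q).IsWeakFCElement (J.map (Ideal.Quotient.mk Q)) (Ideal.Quotient.mk Q x))
    {a : A} (ha : a * x ∈ Q) : a ∈ idealSaturation Q (F.ideal 1) := by
  obtain ⟨k, hk⟩ := h.fc2 (Ideal.Quotient.mk Q a) (by
    rw [← map_mul]; exact Ideal.Quotient.eq_zero_iff_mem.2 ha)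
  refine ⟨k, fun b hb => ?_⟩
  have h1 : Ideal.Quotient.mk Q b ∈ (F.quotient Q).ideal 1 ^ k := by
    change _ ∈ ((F.ideal 1).map _) ^ k
    rw [← Ideal.map_pow]
    exact Ideal.mem_map_of_mem _ hb
  have h2 := hk _ h1
  rwa [← map_mul, Ideal.mem_bot, Ideal.Quotient.eq_zero_iff_mem] at h2

/-- A weak-(FC)-element differentiates the Hilbert function. -/
lemma IsWeakFCElement.exists_hilbertMod_add [IsNoetherianRing A]
    (h : (F.quotient Q).IsWeakFCElement (J.map (Ideal.Quotient.mk Q)) (Ideal.Quotient.mk Q x))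
    {𝔟 : Ideal A} (h𝔟 : F.IsReduction 𝔟) (hx : x ∈ F.ideal 1) :
    ∃ N, ∀ n, N ≤ n → F.hilbertMod J Q (n + 1) =
      F.hilbertMod J Q n + F.hilbertMod J (Q ⊔ Ideal.span {x}) (n + 1) := by
  obtain ⟨N₁, hN₁⟩ := h.exists_inf_le
  obtain ⟨N₂, hN₂⟩ := h𝔟.exists_sup_inf_idealSaturation_le Q
  refine ⟨max N₁ N₂, fun n hn => ?_⟩
  obtain ⟨hfc, hfc'⟩ := hN₁ n ((le_max_left _ _).trans hn)
  have har := hN₂ n ((le_max_right _ _).trans hn)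
  have hxI : Ideal.span {x} * F.ideal n ≤ F.ideal (n + 1) := by
    rw [add_comm n 1]
    exact (Ideal.mul_mono_left ((Ideal.span_singleton_le_iff_mem _).2 hx)).trans (F.mul_le 1 n)
  have hJI (k : ℕ) : J * F.ideal k ≤ F.ideal k := Ideal.mul_le_right
  -- The intermediate module x Iₙ + J Iₙ₊₁ + Q separates the image of multiplication by x from its
  -- cokernel.
  rw [hilbertMod, Submodule.relLength_add
    (N := Ideal.span {x} * F.ideal n ⊔ (J * F.ideal (n + 1) ⊔ Q)) le_sup_right
    (sup_le (hxI.trans le_sup_left) (sup_le_sup_right (hJI _) _))]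
  congr 1
  · symm
    refine Submodule.relLength_eq_of_linearMap (LinearMap.mulLeft A x) (fun a ha => ?_)
      (fun a ha => ⟨fun h1 => ?_, fun h1 => ?_⟩) (fun b hb => ?_)
    · obtain ⟨y, hy, q, hq, rfl⟩ := Submodule.mem_sup.1 ha
      rw [map_add]
      exact Submodule.add_mem_sup (Ideal.mul_mem_mul (Ideal.mem_span_singleton_self x) hy)
        (Submodule.mem_sup_right (Q.mul_mem_left x hq))
    -- Injectivity: (FC₁) with exponent 1 gives xa ≡ xz modulo Q with z ∈ J Iₙ; then (FC₂) puts a -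
    -- z in the saturation, and Artin–Rees puts it in Q.
    · have h2 : x * a ∈ (J * F.ideal (n + 1) ⊔ Q) ⊓ (Ideal.span {x} ⊔ Q) :=
        ⟨h1, Submodule.mem_sup_left (Ideal.mul_mem_right _ _ (Ideal.mem_span_singleton_self x))⟩
      have h3 := hfc' h2
      rw [mul_left_comm] at h3
      obtain ⟨y, hy, q, hq, h4⟩ := Submodule.mem_sup.1 h3
      obtain ⟨z, hz, rfl⟩ := Ideal.mem_span_singleton_mul.1 hy
      have h5 : (a - z) * x ∈ Q := by
        have : (a - z) * x = q := by linear_combination -h4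
        rwa [this]
      have h6 : a - z ∈ Q := har ⟨Ideal.sub_mem _ ha (Submodule.mem_sup_left (hJI _ hz)),
        h.mem_idealSaturation h5⟩
      rw [← add_sub_cancel z a]
      exact Submodule.add_mem_sup hz h6
    · obtain ⟨y, hy, q, hq, rfl⟩ := Submodule.mem_sup.1 h1
      rw [map_add]
      refine Submodule.add_mem_sup (Ideal.mul_mono_right hxI ?_) (Q.mul_mem_left x hq)
      rw [mul_left_comm]
      exact Ideal.mul_mem_mul (Ideal.mem_span_singleton_self x) hy
    · obtain ⟨y, hy, q, hq, rfl⟩ := Submodule.mem_sup.1 hb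
      obtain ⟨z, hz, rfl⟩ := Ideal.mem_span_singleton_mul.1 hy
      exact ⟨z, Submodule.mem_sup_left hz, by simpa using hq⟩
  · refine Submodule.relLength_eq_of_linearMap LinearMap.id
      (fun a ha => (sup_le_sup_left le_sup_left _ : F.ideal (n + 1) ⊔ Q ≤ _) ha)
      (fun a ha => ⟨fun h1 => ?_, fun h1 => ?_⟩) (fun b hb => ?_)
    · obtain ⟨y, hy, z, hz, h2⟩ := Submodule.mem_sup.1 h1
      rw [LinearMap.id_apply] at h2
      have h3 : z ∈ Ideal.span {x} * F.ideal n ⊔ Q := by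
        refine hfc ⟨?_, by rwa [sup_comm]⟩
        rw [← add_sub_cancel_left y z, h2]
        exact Ideal.sub_mem _ ha (Submodule.mem_sup_left (hJI _ hy))
      obtain ⟨w, hw, q, hq, rfl⟩ := Submodule.mem_sup.1 h3
      rw [← h2, add_left_comm]
      exact Submodule.add_mem_sup hw (Submodule.add_mem_sup hy hq)
    · have h2 : Ideal.span {x} * F.ideal n ≤ J * F.ideal (n + 1) ⊔ (Q ⊔ Ideal.span {x}) :=
        Ideal.mul_le_left.trans (le_sup_right.trans le_sup_right)
      exact (sup_le h2 (sup_le_sup_left le_sup_left _) : _ ≤ _) h1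
    · obtain ⟨a, ha, p, hp, rfl⟩ := Submodule.mem_sup.1 hb
      exact ⟨a, Submodule.mem_sup_left ha, Submodule.mem_sup_right (by simpa using hp)⟩

end WeakFC

end IdealFiltration

/-! ### Weak-(FC)-sequences: reduction and leading coefficients. -/

namespace IdealFiltration

section

variable {A : Type u} [CommRing A] {F : IdealFiltration A} {J : Ideal A} {l : ℕ} {x : Fin l → A}

lemma IsWeakFCSequence.not_ideal_le (hx : F.IsWeakFCSequence J x) {i : ℕ} (hi : i < l) (n : ℕ) :
    ¬ F.ideal n ≤ initialIdeal x i := by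
  intro h
  refine (hx.2 ⟨i, hi⟩).not_nilpotent ⟨n, fun m hm => ?_⟩
  refine (Ideal.map_eq_bot_iff_le_ker _).2 ?_
  rw [Ideal.mk_ker]
  exact (F.ideal_antitone hm).trans h

/-- (FC₁) modulo the earlier elements splits off a member of xᵢ₊₁ Iₙ; the rest lies in (x₁, …, xᵢ)
and still in Iₙ₊₁, so induction applies. -/
lemma IsWeakFCSequence.exists_inf_initialIdeal_le (hx : F.IsWeakFCSequence J x) {i : ℕ}
    (hi : i ≤ l) :
    ∃ N, ∀ n, N ≤ n → F.ideal (n + 1) ⊓ initialIdeal x i ≤ initialIdeal x i * F.ideal n := by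
  induction i with
  | zero =>
    refine ⟨0, fun n _ => ?_⟩
    rw [initialIdeal_zero, inf_bot_eq]
    exact bot_le
  | succ i ih =>
    obtain ⟨N₁, hN₁⟩ := ih (by omega)
    obtain ⟨N₂, hN₂⟩ := (hx.2 ⟨i, hi⟩).exists_inf_le
    refine ⟨max N₁ N₂, fun n hn => ?_⟩
    have h1 := hN₁ n ((le_max_left _ _).trans hn)
    have h2 := (hN₂ n ((le_max_right _ _).trans hn)).1
    have h3 := initialIdeal_succ x ⟨i, hi⟩
    simp only at h1 h2 h3
    rw [h3]
    rintro a ⟨ha, ha'⟩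
    obtain ⟨y, hy, q, hq, rfl⟩ := Submodule.mem_sup.1
      (h2 ⟨Submodule.mem_sup_left ha, by rwa [sup_comm]⟩)
    have hyI : y ∈ F.ideal (n + 1) := by
      have : Ideal.span {x ⟨i, hi⟩} * F.ideal n ≤ F.ideal (1 + n) :=
        (Ideal.mul_mono_left ((Ideal.span_singleton_le_iff_mem _).2 (hx.1 _))).trans (F.mul_le 1 n)
      rw [add_comm n 1]
      exact this hy
    have hqI : q ∈ F.ideal (n + 1) := by
      have := Ideal.sub_mem _ ha hyI
      rwa [add_sub_cancel_left] at this
    rw [Ideal.sup_mul]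
    rw [add_comm]
    exact Submodule.add_mem_sup (h1 ⟨hqI, hq⟩) hy

end

open IsLocalRing

variable {A : Type u} [CommRing A] [IsLocalRing A] [IsNoetherianRing A] {F : IdealFiltration A}
  {J 𝔟 : Ideal A} {l : ℕ} {x : Fin l → A}

/-- The Hilbert function of `F/(x₁, …, xᵢ)`, with real values. -/
noncomputable def sequenceHilbert (F : IdealFiltration A) (J : Ideal A) (x : Fin l → A)
    (i n : ℕ) : ℝ :=
  (F.hilbertMod J (initialIdeal x i) n).toNat

lemma IsWeakFCSequence.eventually_sequenceHilbert (hx : F.IsWeakFCSequence J x)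
    (h : F.IsReduction 𝔟) {c : ℕ} (hc : maximalIdeal A ^ c ≤ J) {i : ℕ} (hi : i < l) :
    ∀ᶠ n in atTop, F.sequenceHilbert J x i (n + 1) =
      F.sequenceHilbert J x i n + F.sequenceHilbert J x (i + 1) (n + 1) := by
  obtain ⟨N, hN⟩ := (hx.2 ⟨i, hi⟩).exists_hilbertMod_add h (hx.1 _)
  filter_upwards [eventually_ge_atTop N] with n hn
  have h1 := hN n hn
  rw [← initialIdeal_succ] at h1
  have h2 := congrArg ENat.toNat h1
  rw [ENat.toNat_add (hilbertMod_ne_top hc _ _) (hilbertMod_ne_top hc _ _)] at h2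
  simp only [sequenceHilbert]
  exact_mod_cast h2

lemma one_le_sequenceHilbert (hJ : J ≤ maximalIdeal A) {c : ℕ} (hc : maximalIdeal A ^ c ≤ J)
    {i n : ℕ} (h : ¬ F.ideal n ≤ initialIdeal x i) : 1 ≤ F.sequenceHilbert J x i n := by
  rw [← hilbertMod_eq_zero_iff hJ] at h
  have h1 : F.hilbertMod J (initialIdeal x i) n ≠ ⊤ := hilbertMod_ne_top hc _ _
  have h2 : (F.hilbertMod J (initialIdeal x i) n).toNat ≠ 0 := fun h3 =>
    (ENat.toNat_eq_zero.1 h3).elim h h1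
  rw [sequenceHilbert]
  exact_mod_cast Nat.one_le_iff_ne_zero.2 h2

/-- If `F/(x₁, …, xₗ)` were not nilpotent, the Hilbert function of `F` would grow at least like
`nˡ`. -/
lemma IsWeakFCSequence.exists_mul_pow_le_sequenceHilbert (hx : F.IsWeakFCSequence J x)
    (h : F.IsReduction 𝔟) (hJ : J ≤ maximalIdeal A) {c : ℕ} (hc : maximalIdeal A ^ c ≤ J)
    (hnil : ∀ n, ¬ F.ideal n ≤ initialIdeal x l) {i j : ℕ} (hij : i + j = l) :
    ∃ C > 0, ∀ᶠ n : ℕ in atTop, C * (n : ℝ) ^ j ≤ F.sequenceHilbert J x i n := by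
  induction j generalizing i with
  | zero =>
    obtain rfl : i = l := by simpa using hij
    refine ⟨1, one_pos, Eventually.of_forall fun n => ?_⟩
    simpa using one_le_sequenceHilbert hJ hc (hnil n)
  | succ j ih =>
    obtain ⟨C, hC, h1⟩ := ih (i := i + 1) (by omega)
    refine exists_mul_pow_succ_le (g := fun n => F.sequenceHilbert J x (i + 1) (n + 1))
      ⟨C, hC, ?_⟩ ?_
    · filter_upwards [(tendsto_add_atTop_nat 1).eventually h1] with n hn
      refine le_trans ?_ hn
      gcongr
      omega
    · filter_upwards [hx.eventually_sequenceHilbert h hc (i := i) (by omega)] with n hn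
      exact hn.symm.le

/-- A weak-(FC)-sequence of length `ℓ(F)` exhausts the filtration. -/
lemma IsWeakFCSequence.exists_ideal_le (hx : F.IsWeakFCSequence J x)
    (h : F.IsReduction 𝔟) (hJ : J ≤ maximalIdeal A) {c : ℕ} (hc : maximalIdeal A ^ c ≤ J)
    (hl : F.analyticSpread ≤ l) : ∃ n, F.ideal n ≤ initialIdeal x l := by
  by_contra! hnil
  obtain ⟨C, hC, h1⟩ := hx.exists_mul_pow_le_sequenceHilbert h hJ hc hnil (zero_add l)
  obtain ⟨D, hD⟩ := h.exists_sum_hilbert_le (J := maximalIdeal A) (c := 1) le_rfl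
    (pow_one _).le hl
  obtain ⟨K, hK⟩ := ENat.ne_top_iff_exists.1 (length_quotient_ne_top hc)
  have h2 (k : ℕ) : F.sequenceHilbert J x 0 k ≤ K * (F.hilbert (maximalIdeal A) k).toNat := by
    have h3 := hilbert_le_hilbert_maximalIdeal_mul (F := F) (J := J) k
    rw [← hK, ← ENat.natCast_toNat (hilbert_ne_top (F := F) hc k), ← ENat.natCast_toNat
      (hilbert_ne_top (F := F) (J := maximalIdeal A) (c := 1) (pow_one _).le k)] at h3
    rw [sequenceHilbert, initialIdeal_zero, hilbertMod_bot, mul_comm]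
    exact_mod_cast h3
  have h4 (n : ℕ) : ∑ k ∈ Finset.range n, F.sequenceHilbert J x 0 k ≤
      K * (D * ((n : ℝ) + 1 + 1) ^ l) := by
    have h5 := hD n
    rw [sum_hilbert_eq_coe (c := 1) (pow_one _).le] at h5
    have h6 : ∑ k ∈ Finset.range n, (F.hilbert (maximalIdeal A) k).toNat ≤
      D * (n + 1 + 1) ^ l := by exact_mod_cast h5
    calc ∑ k ∈ Finset.range n, F.sequenceHilbert J x 0 k
        ≤ ∑ k ∈ Finset.range n, (K * (F.hilbert (maximalIdeal A) k).toNat : ℝ) :=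
          Finset.sum_le_sum fun k _ => h2 k
      _ = K * ((∑ k ∈ Finset.range n, (F.hilbert (maximalIdeal A) k).toNat : ℕ) : ℝ) := by
          rw [← Finset.mul_sum]; push_cast; rfl
      _ ≤ K * (D * ((n : ℝ) + 1 + 1) ^ l) := by
          gcongr
          exact_mod_cast h6
  -- Summation raises the exponent to l + 1, one more than the dimension allows.
  obtain ⟨C', hC', h7⟩ := exists_mul_pow_succ_le
    (f := fun n => ∑ k ∈ Finset.range n, F.sequenceHilbert J x 0 k) ⟨C, hC, h1⟩
    (Eventually.of_forall fun n => (Finset.sum_range_succ _ n).ge)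
  -- The factor 3 ^ l comes from n + 2 ≤ 3n for n ≥ 1.
  obtain ⟨n, hn, hn0, hn1⟩ := (h7.and ((eventually_gt_atTop 0).and
    ((tendsto_natCast_atTop_atTop (R := ℝ)).eventually_gt_atTop
      (K * D * 3 ^ l / C')))).exists
  have hn0' : (1 : ℝ) ≤ n := by exact_mod_cast hn0
  have h8 : C' * (n : ℝ) ^ (l + 1) ≤ K * D * 3 ^ l * (n : ℝ) ^ l := by
    refine (hn.trans (h4 n)).trans ?_
    have h9 : ((n : ℝ) + 1 + 1) ^ l ≤ (3 * n) ^ l := by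
      gcongr
      linarith
    rw [mul_pow] at h9
    calc (K : ℝ) * (D * ((n : ℝ) + 1 + 1) ^ l) ≤ K * (D * (3 ^ l * (n : ℝ) ^ l)) := by gcongr
      _ = _ := by ring
  rw [div_lt_iff₀ hC'] at hn1
  have h10 : (0 : ℝ) < (n : ℝ) ^ l := by positivity
  have h11 := mul_lt_mul_of_pos_right hn1 h10
  rw [pow_succ] at h8
  linarith

/-- A weak-(FC)-sequence of length `ℓ(F)` generates a reduction of `F`. -/
lemma IsWeakFCSequence.isReduction (hx : F.IsWeakFCSequence J x)
    (h : F.IsReduction 𝔟) (hJ : J ≤ maximalIdeal A) {c : ℕ} (hc : maximalIdeal A ^ c ≤ J)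
    (hl : F.analyticSpread ≤ l) : F.IsReduction (initialIdeal x l) := by
  obtain ⟨m, hm⟩ := hx.exists_ideal_le h hJ hc hl
  obtain ⟨N, hN⟩ := hx.exists_inf_initialIdeal_le le_rfl
  have h1 : initialIdeal x l ≤ F.ideal 1 := by
    rw [initialIdeal_eq_span_range, Ideal.span_le]
    rintro _ ⟨i, rfl⟩
    exact hx.1 i
  have h2 (n : ℕ) : initialIdeal x l * F.ideal n ≤ F.ideal (n + 1) := by
    rw [add_comm]
    exact (Ideal.mul_mono_left h1).trans (F.mul_le 1 n)
  refine ⟨h2, max N m, fun n hn => le_antisymm ?_ (h2 n)⟩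
  refine le_trans (le_inf le_rfl ?_) (hN n ((le_max_left _ _).trans hn))
  exact (F.ideal_antitone (by have := (le_max_right N m).trans hn; omega)).trans hm

/-- The Hilbert functions of the filtrations `F/(x₁, …, xᵢ)` have the same normalized leading
coefficient. -/
lemma IsWeakFCSequence.exists_tendsto_sequenceHilbert (hx : F.IsWeakFCSequence J x)
    (h : F.IsReduction 𝔟) (hJ : J ≤ maximalIdeal A) {c : ℕ} (hc : maximalIdeal A ^ c ≤ J)
    (hl : F.analyticSpread ≤ l) (hl0 : 0 < l) :
    ∃ e : ℝ, 0 < e ∧ ∀ i j, i + j + 1 = l →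
      Tendsto (fun n : ℕ => F.sequenceHilbert J x i n / (n : ℝ) ^ j) atTop
        (𝓝 (e / (Nat.factorial j : ℝ))) := by
  obtain ⟨m, hm⟩ := hx.exists_ideal_le h hJ hc hl
  obtain ⟨k, rfl⟩ : ∃ k, l = k + 1 := ⟨l - 1, by omega⟩
  have h0 (n : ℕ) (hn : m ≤ n) : F.sequenceHilbert J x (k + 1) n = 0 := by
    have := (hilbertMod_eq_zero_iff (F := F) hJ).2 ((F.ideal_antitone hn).trans hm)
    simp [sequenceHilbert, this]
  obtain ⟨N, hN⟩ := eventually_atTop.1 (hx.eventually_sequenceHilbert h hc (i := k) (by omega))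
  -- Beyond M the recursion holds at level k and its last term vanishes, so the Hilbert function at
  -- level k is constant.
  set M := max N m with hM
  have hconst (n : ℕ) (hn : M ≤ n) : F.sequenceHilbert J x k n = F.sequenceHilbert J x k M := by
    induction n, hn using Nat.le_induction with
    | base => rfl
    | succ n hn ih =>
      rw [hN n ((le_max_left _ _).trans hn),
        h0 (n + 1) (((le_max_right _ _).trans hn).trans (Nat.le_succ n)), add_zero, ih]
  refine ⟨F.sequenceHilbert J x k M,
    lt_of_lt_of_le one_pos (one_le_sequenceHilbert hJ hc (hx.not_ideal_le (by omega) M)), ?_⟩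
  intro i j
  induction j generalizing i with
  | zero =>
    intro hij
    obtain rfl : i = k := by omega
    refine tendsto_const_nhds.congr' ?_
    filter_upwards [eventually_ge_atTop M] with n hn
    simp [hconst n hn]
  | succ j ih =>
    intro hij
    -- The shift is needed because the difference at n is the next Hilbert function at n + 1.
    have h1 := tendsto_shift_div_pow 1 (ih (i + 1) (by omega))
    have h2 := tendsto_div_pow_of_sub (f := F.sequenceHilbert J x i) h1 (by
      filter_upwards [hx.eventually_sequenceHilbert h hc (i := i) (by omega)] with n hn
      rw [hn, add_sub_cancel_left])
    have h3 : F.sequenceHilbert J x k M / (Nat.factorial j : ℝ) / (j + 1) =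
        F.sequenceHilbert J x k M / (Nat.factorial (j + 1) : ℝ) := by
      rw [div_div, Nat.factorial_succ]
      push_cast
      rw [mul_comm ((j : ℝ) + 1)]
    rwa [h3] at h2

end IdealFiltration

/-! ### Passage to quotients, and colengths. -/

namespace IdealFiltration

section Quotient

open IsLocalRing

variable {A : Type u} [CommRing A] {F : IdealFiltration A}

lemma IsReduction.quotient {𝔟 : Ideal A} (h : F.IsReduction 𝔟) (P : Ideal A) :
    (F.quotient P).IsReduction (𝔟.map (Ideal.Quotient.mk P)) := by
  refine ⟨fun n => ?_, h.2.imp fun N hN n hn => ?_⟩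
  · change _ * (F.ideal n).map _ ≤ (F.ideal (n + 1)).map _
    rw [← Ideal.map_mul]
    exact Ideal.map_mono (h.1 n)
  · change (F.ideal (n + 1)).map _ = _ * (F.ideal n).map _
    rw [← Ideal.map_mul, hN n hn]

variable [IsLocalRing A]

lemma comap_maximalIdeal_quotient (P : Ideal A) [IsLocalRing (A ⧸ P)] :
    (maximalIdeal (A ⧸ P)).comap (Ideal.Quotient.mk P) = maximalIdeal A :=
  eq_maximalIdeal (Ideal.comap_isMaximal_of_surjective _ Ideal.Quotient.mk_surjective)

lemma map_maximalIdeal_quotient (P : Ideal A) [IsLocalRing (A ⧸ P)] :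
    (maximalIdeal A).map (Ideal.Quotient.mk P) = maximalIdeal (A ⧸ P) := by
  rw [← comap_maximalIdeal_quotient P,
    Ideal.map_comap_of_surjective _ Ideal.Quotient.mk_surjective]

/-- Only generators of 𝔞 modulo P count towards the dimension, so t may be much smaller than a
generating set of 𝔞. -/
lemma hasFiberMultiplicity_quotient_of_tendsto [IsNoetherianRing A] {J P : Ideal A} (hP : P ≠ ⊤)
    (hJ : J ≤ maximalIdeal A) {c : ℕ} (hc : maximalIdeal A ^ c ≤ J) {𝔞 : Ideal A}
    (h𝔞 : F.IsReduction 𝔞) {t : Finset A} (ht : 𝔞 ≤ Ideal.span (t : Set A) ⊔ P)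
    (ht' : (t : Set A) ⊆ 𝔞) {j : ℕ} (hj : t.card ≤ j + 1)
    {e : ℝ} (he : 0 < e)
    (h : Tendsto (fun n : ℕ => ((F.hilbertMod J P n).toNat : ℝ) / (n : ℝ) ^ j) atTop
      (𝓝 (e / (Nat.factorial j : ℝ)))) :
    (F.quotient P).HasFiberMultiplicity (J.map (Ideal.Quotient.mk P)) e := by
  classical
  have : Nontrivial (A ⧸ P) := Ideal.Quotient.nontrivial_iff.2 hP
  have : IsLocalRing (A ⧸ P) :=
    IsLocalRing.of_surjective' (Ideal.Quotient.mk P) Ideal.Quotient.mk_surjective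
  have hspan : 𝔞.map (Ideal.Quotient.mk P) =
      Ideal.span ((t.image (Ideal.Quotient.mk P) : Finset _) : Set (A ⧸ P)) := by
    rw [Finset.coe_image, ← Ideal.map_span]
    refine le_antisymm ((Ideal.map_mono ht).trans ?_) (Ideal.map_mono (Ideal.span_le.2 ht'))
    rw [Ideal.map_sup, Ideal.map_quotient_self, sup_bot_eq]
  have hred := h𝔞.quotient P
  rw [hspan] at hred
  refine hasFiberMultiplicity_of_tendsto (c := c) ?_ ?_ hred (Finset.card_image_le.trans hj) he ?_
  · rw [← map_maximalIdeal_quotient]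
    exact Ideal.map_mono hJ
  · rw [← map_maximalIdeal_quotient, ← Ideal.map_pow]
    exact Ideal.map_mono hc
  · simpa only [hilbert_quotient] using h

end Quotient

section Colength

variable {A : Type u} [CommRing A] (F : IdealFiltration A)

lemma ideal_mul_prevIdeal_le (m n : ℕ) : F.ideal m * F.prevIdeal n ≤ F.prevIdeal (m + n) := by
  cases n with
  | zero =>
    change F.ideal m * ⊥ ≤ _
    rw [Ideal.mul_bot]
    exact bot_le
  | succ n => exact F.mul_le m n

/-- The elements of the Rees algebra whose coefficients of degree `n` lie in
`J Iₙ + 𝔞 Iₙ₋₁ + P`. -/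
def colengthIdeal (J 𝔞 P : Ideal A) : Ideal F.rees where
  carrier := {f | ∀ n, (f : A[X]).coeff n ∈ J * F.ideal n ⊔ 𝔞 * F.prevIdeal n ⊔ P}
  add_mem' := by
    intro f g hf hg n
    simpa using Ideal.add_mem _ (hf n) (hg n)
  zero_mem' := by
    intro n
    simp
  smul_mem' := by
    intro c f hf n
    rw [smul_eq_mul, Subalgebra.coe_mul, coeff_mul]
    refine Ideal.sum_mem _ ?_
    rintro ⟨i, j⟩ e
    rw [← Finset.HasAntidiagonal.mem_antidiagonal.mp e]
    have h1 := Ideal.mul_mem_mul (c.2 i) (hf j)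
    rw [Ideal.mul_sup, Ideal.mul_sup, mul_left_comm, mul_left_comm _ 𝔞] at h1
    exact (sup_le_sup (sup_le_sup (Ideal.mul_mono_right (F.mul_le i j))
      (Ideal.mul_mono_right (F.ideal_mul_prevIdeal_le i j))) Ideal.mul_le_right : _ ≤ _) h1

variable {F}

lemma comap_degreeOneIdeal (J : Ideal A) {𝔞 : Ideal A} (h𝔞 : 𝔞 ≤ F.ideal 1) :
    (F.degreeOneIdeal J 𝔞).comap (F.toFiberCone J) = F.colengthIdeal J 𝔞 ⊥ := by
  set T : Set F.rees := {f | ∃ a ∈ 𝔞, (f : A[X]) = monomial 1 a} with hT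
  have h1 : F.degreeOneIdeal J 𝔞 = (Ideal.span T).map (F.toFiberCone J) := by
    rw [Ideal.map_span]
    rfl
  rw [h1, Ideal.comap_map_of_surjective' _ (F.toFiberCone_surjective J), ker_toFiberCone]
  refine le_antisymm (sup_le (Ideal.span_le.2 ?_) fun f hf n =>
    Submodule.mem_sup_left (Submodule.mem_sup_left (hf n))) fun f hf =>
      mem_of_forall_coeff_mem fun n => ?_
  · rintro f ⟨a, ha, hf⟩ n
    rw [hf, coeff_monomial]
    split_ifs with h
    · subst h
      refine Submodule.mem_sup_left (Submodule.mem_sup_right ?_)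
      change a ∈ 𝔞 * F.ideal 0
      rwa [F.ideal_zero, Ideal.mul_top]
    · exact Ideal.zero_mem _
  · have h2 := hf n
    rw [sup_bot_eq] at h2
    refine (sup_le ((mul_ideal_le_degreePart_fiberIdeal J n).trans (degreePart_mono le_sup_right _))
      (le_trans ?_ (degreePart_mono le_sup_left _)) : _ ≤ _) h2
    cases n with
    | zero =>
      change 𝔞 * ⊥ ≤ _
      rw [Ideal.mul_bot]
      exact bot_le
    | succ n =>
      have h3 : 𝔞 ≤ degreePart (Ideal.span T) 1 := fun a ha =>
        ⟨F.reesMonomial (h𝔞 ha), Ideal.subset_span ⟨a, ha, rfl⟩, rfl⟩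
      have h4 := (Ideal.mul_mono_left h3).trans (degreePart_mul_ideal_le _ 1 n)
      rwa [add_comm 1 n] at h4

lemma fiberColength_eq (B : Type v) [CommRing B] [Algebra B A] (J : Ideal A) {𝔞 : Ideal A}
    (h𝔞 : 𝔞 ≤ F.ideal 1) :
    F.fiberColength B J 𝔞 =
      Submodule.relLength ((F.colengthIdeal J 𝔞 ⊥).restrictScalars B) ⊤ := by
  rw [fiberColength, ← (Submodule.Quotient.restrictScalarsEquiv B
    (F.degreeOneIdeal J 𝔞)).length_eq, ← Submodule.relLength_top]
  symm
  refine Submodule.relLength_eq_of_linearMap (F.toFiberConeLinear J B) (fun _ _ => trivial)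
    (fun f _ => ?_) (fun z _ => ?_)
  · rw [toFiberConeLinear_apply]
    change F.toFiberCone J f ∈ F.degreeOneIdeal J 𝔞 ↔ f ∈ F.colengthIdeal J 𝔞 ⊥
    rw [← comap_degreeOneIdeal J h𝔞, Ideal.mem_comap]
  · obtain ⟨f, hf⟩ := F.toFiberCone_surjective J z
    refine ⟨f, trivial, ?_⟩
    rw [toFiberConeLinear_apply, hf, sub_self]
    exact Submodule.zero_mem _

variable (F) in
/-- The reduction map from the Rees algebra of `F` to that of `F/P`. -/
noncomputable def reesQuotient (P : Ideal A) : F.rees →ₗ[A] (F.quotient P).rees where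
  toFun f := ⟨(f : A[X]).map (Ideal.Quotient.mk P), fun n => by
    rw [coeff_map]
    exact Ideal.mem_map_of_mem _ (f.2 n)⟩
  map_add' f g := Subtype.ext (Polynomial.map_add _)
  map_smul' a f := by
    refine Subtype.ext (Polynomial.ext fun n => ?_)
    change ((a • (f : A[X])).map _).coeff n = (a • (f : A[X]).map _).coeff n
    rw [coeff_map, coeff_smul, coeff_smul, coeff_map]
    rfl

lemma coeff_reesQuotient (P : Ideal A) (f : F.rees) (n : ℕ) :
    (F.reesQuotient P f : (A ⧸ P)[X]).coeff n = Ideal.Quotient.mk P ((f : A[X]).coeff n) :=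
  coeff_map _ _

lemma reesQuotient_surjective (P : Ideal A) : Function.Surjective (F.reesQuotient P) := by
  intro g
  have h1 (n : ℕ) : ∃ a ∈ F.ideal n, Ideal.Quotient.mk P a = (g : (A ⧸ P)[X]).coeff n :=
    (Ideal.mem_map_iff_of_surjective _ Ideal.Quotient.mk_surjective).1 (g.2 n)
  choose a ha hag using h1
  refine ⟨∑ n ∈ (g : (A ⧸ P)[X]).support, F.reesMonomial (ha n), ?_⟩
  refine Subtype.ext ?_
  rw [map_sum, AddSubmonoidClass.coe_finsetSum]
  refine Eq.trans (Finset.sum_congr rfl fun n _ => ?_) (g : (A ⧸ P)[X]).as_sum_support.symm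
  change (monomial n (a n)).map _ = _
  rw [Polynomial.map_monomial, hag]

lemma prevIdeal_quotient (P : Ideal A) (n : ℕ) :
    (F.quotient P).prevIdeal n = (F.prevIdeal n).map (Ideal.Quotient.mk P) := by
  cases n with
  | zero => exact Ideal.map_bot.symm
  | succ n => rfl

/-- Brings the colengths of all quotients back to one Rees algebra, where they can be compared
through inclusions of ideals. -/
lemma fiberColength_quotient (J P : Ideal A) {𝔞 : Ideal A} (h𝔞 : 𝔞 ≤ F.ideal 1) :
    (F.quotient P).fiberColength A (J.map (Ideal.Quotient.mk P)) (𝔞.map (Ideal.Quotient.mk P)) =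
      Submodule.relLength ((F.colengthIdeal J 𝔞 P).restrictScalars A) ⊤ := by
  rw [fiberColength_eq A _ (Ideal.map_mono h𝔞)]
  symm
  refine Submodule.relLength_eq_of_linearMap (F.reesQuotient P) (fun _ _ => trivial)
    (fun f _ => ?_) (fun z _ => ?_)
  · refine forall_congr' fun n => ?_
    rw [coeff_reesQuotient, sup_bot_eq, prevIdeal_quotient]
    change _ ∈ _ * (F.ideal n).map _ ⊔ _ ↔ _
    rw [← Ideal.map_mul, ← Ideal.map_mul, ← Ideal.map_sup, Ideal.mem_quotient_iff_mem_sup]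
  · obtain ⟨f, hf⟩ := F.reesQuotient_surjective P z
    refine ⟨f, trivial, ?_⟩
    rw [hf, sub_self]
    exact Submodule.zero_mem _

lemma colengthIdeal_mono (J 𝔞 : Ideal A) {P Q : Ideal A} (h : P ≤ Q) :
    F.colengthIdeal J 𝔞 P ≤ F.colengthIdeal J 𝔞 Q :=
  fun _ hf n => (sup_le_sup_left h _ : _ ≤ _) (hf n)

/-- Since J Iₙ + 𝔞 Iₙ₋₁ ⊆ Iₙ, the P-component of a coefficient lies in Iₙ ∩ P; conversely monomials
test each degree. -/
lemma colengthIdeal_le_iff {J 𝔞 P : Ideal A} (h𝔞 : 𝔞 ≤ F.ideal 1) :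
    F.colengthIdeal J 𝔞 P ≤ F.colengthIdeal J 𝔞 ⊥ ↔
      ∀ n, F.ideal n ⊓ P ≤ 𝔞 * F.prevIdeal n ⊔ J * F.ideal n := by
  have hle (n : ℕ) : J * F.ideal n ⊔ 𝔞 * F.prevIdeal n ≤ F.ideal n := by
    refine sup_le Ideal.mul_le_right ?_
    cases n with
    | zero =>
      change 𝔞 * ⊥ ≤ _
      rw [Ideal.mul_bot]
      exact bot_le
    | succ n =>
      have h1 := (Ideal.mul_mono_left h𝔞).trans (F.mul_le 1 n)
      rwa [add_comm 1 n] at h1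
  constructor
  · intro h n a ha
    have h1 : F.reesMonomial ha.1 ∈ F.colengthIdeal J 𝔞 P := fun k => by
      rw [coe_reesMonomial, coeff_monomial]
      split_ifs with hk
      · exact hk ▸ Submodule.mem_sup_right ha.2
      · exact Ideal.zero_mem _
    have h2 := h h1 n
    rwa [coe_reesMonomial, coeff_monomial, if_pos rfl, sup_bot_eq, sup_comm] at h2
  · intro h f hf n
    obtain ⟨y, hy, p, hp, h1⟩ := Submodule.mem_sup.1 (hf n)
    rw [sup_bot_eq, ← h1]
    refine Ideal.add_mem _ hy ?_
    rw [sup_comm]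
    refine h n ⟨?_, hp⟩
    rw [← add_sub_cancel_left y p, h1]
    exact Ideal.sub_mem _ (f.2 n) (hle n hy)

lemma IsReduction.fiberTail_le_colengthIdeal {𝔞 : Ideal A} (h : F.IsReduction 𝔞) (J : Ideal A) :
    ∃ N, F.fiberTail J N ≤ F.colengthIdeal J 𝔞 ⊥ := by
  obtain ⟨N, hN⟩ := h.2
  refine ⟨N + 1, fun f hf n => ?_⟩
  rw [sup_bot_eq]
  by_cases hn : n < N + 1
  · exact Submodule.mem_sup_left (hf n hn)
  · obtain ⟨n, rfl⟩ : ∃ k, n = k + 1 := ⟨n - 1, by omega⟩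
    have h1 := f.2 (n + 1)
    rw [hN n (by omega)] at h1
    exact Submodule.mem_sup_right h1

lemma IsReduction.ideal_le_of_reductionNumber_lt {𝔞 : Ideal A} (h : F.IsReduction 𝔞) {n : ℕ}
    (hn : F.reductionNumber 𝔞 < n) : F.ideal n ≤ 𝔞 * F.prevIdeal n := by
  obtain ⟨n, rfl⟩ : ∃ k, n = k + 1 := ⟨n - 1, by omega⟩
  have hne : {n | ∀ m, n ≤ m → 𝔞 * F.ideal m = F.ideal (m + 1)}.Nonempty :=
    h.2.imp fun N hN m hm => (hN m hm).symm
  exact (Nat.sInf_mem hne n (Nat.lt_succ_iff.1 hn)).ge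

end Colength

end IdealFiltration

/-! ### Assembly of the multiplicity and colength statements. -/

namespace IdealFiltration

open IsLocalRing

variable {A : Type u} [CommRing A] [IsLocalRing A] [IsNoetherianRing A] {F : IdealFiltration A}
  {J 𝔟 : Ideal A} {l : ℕ} {x : Fin l → A}

/-- The multiplicities of `F` and of its quotients by ideals `P ⊇ (x₁, …, xᵢ)` with the same Hilbert
function as `F/(x₁, …, xᵢ)` are computed by the leading coefficient of that function. -/
lemma IsWeakFCSequence.hasFiberMultiplicity_quotient (hx : F.IsWeakFCSequence J x)
    (h𝔞 : F.IsReduction (initialIdeal x l)) (hJ : J ≤ maximalIdeal A) {c : ℕ}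
    (hc : maximalIdeal A ^ c ≤ J) {e : ℝ} (he : 0 < e) {i j : ℕ} (hij : i + j + 1 = l)
    (hlim : Tendsto (fun n : ℕ => F.sequenceHilbert J x i n / (n : ℝ) ^ j) atTop
      (𝓝 (e / (Nat.factorial j : ℝ)))) {P : Ideal A} (hP : initialIdeal x i ≤ P)
    (hH : ∀ᶠ n in atTop, F.hilbertMod J P n = F.hilbertMod J (initialIdeal x i) n) :
    (F.quotient P).HasFiberMultiplicity (J.map (Ideal.Quotient.mk P)) e := by
  classical
  -- The j + 1 members of the sequence after the first i; the others vanish modulo P.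
  set t : Finset A := Finset.univ.image (fun k : Fin (j + 1) => x ⟨i + k, by omega⟩) with ht
  refine hasFiberMultiplicity_quotient_of_tendsto (j := j) ?_ hJ hc h𝔞 (t := t) ?_ ?_ ?_ he ?_
  -- P = A would make the Hilbert function of F/(x₁, …, xᵢ) vanish somewhere, against
  -- non-nilpotency.
  · rintro rfl
    obtain ⟨n, hn⟩ := hH.exists
    rw [(hilbertMod_eq_zero_iff hJ).2 le_top] at hn
    exact hx.not_ideal_le (by omega) n ((hilbertMod_eq_zero_iff hJ).1 hn.symm)
  · rw [initialIdeal, Ideal.span_le]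
    rintro _ ⟨k, _, rfl⟩
    by_cases hk : (k : ℕ) < i
    · exact Submodule.mem_sup_right (hP (Ideal.subset_span ⟨k, hk, rfl⟩))
    · refine Submodule.mem_sup_left (Ideal.subset_span (Finset.mem_image.2
        ⟨⟨k - i, by omega⟩, Finset.mem_univ _, ?_⟩))
      congr 1
      exact Fin.ext (by simp only; omega)
  · intro a ha
    obtain ⟨k, _, rfl⟩ := Finset.mem_image.1 ha
    exact Ideal.subset_span ⟨_, Fin.is_lt _, rfl⟩
  · exact Finset.card_image_le.trans (by simp)
  · refine hlim.congr' ?_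
    filter_upwards [hH] with n hn
    rw [hn, sequenceHilbert]

lemma hasFiberMultiplicity_of_tendsto_sequenceHilbert
    (h𝔞 : F.IsReduction (initialIdeal x l)) (hJ : J ≤ maximalIdeal A) {c : ℕ}
    (hc : maximalIdeal A ^ c ≤ J) {e : ℝ} (he : 0 < e) {j : ℕ} (hj : j + 1 = l)
    (hlim : Tendsto (fun n : ℕ => F.sequenceHilbert J x 0 n / (n : ℝ) ^ j) atTop
      (𝓝 (e / (Nat.factorial j : ℝ)))) : F.HasFiberMultiplicity J e := by
  classical
  have hspan : initialIdeal x l = Ideal.span ((Finset.univ.image x : Finset A) : Set A) := by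
    rw [initialIdeal_eq_span_range, Finset.coe_image, Finset.coe_univ, Set.image_univ]
  rw [hspan] at h𝔞
  refine hasFiberMultiplicity_of_tendsto hJ hc h𝔞 (j := j) ?_ he ?_
  · exact Finset.card_image_le.trans (by simp [hj])
  · refine hlim.congr fun n => ?_
    rw [sequenceHilbert, initialIdeal_zero, hilbertMod_bot]

/-- The colengths of `F/P` decrease in `P`; the drop from `F` to `F/P` is detected degreewise. -/
lemma IsReduction.fiberColength_quotient {𝔞 : Ideal A} (h𝔞 : F.IsReduction 𝔞) {c : ℕ}
    (hc : maximalIdeal A ^ c ≤ J) {Q P : Ideal A} (hQP : Q ≤ P) :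
    ((F.quotient P).fiberColength A (J.map (Ideal.Quotient.mk P)) (𝔞.map (Ideal.Quotient.mk P)) ≤
        (F.quotient Q).fiberColength A (J.map (Ideal.Quotient.mk Q))
          (𝔞.map (Ideal.Quotient.mk Q)) ∧
      (F.quotient Q).fiberColength A (J.map (Ideal.Quotient.mk Q))
          (𝔞.map (Ideal.Quotient.mk Q)) ≤ F.fiberColength A J 𝔞 ∧
      F.fiberColength A J 𝔞 ≠ ⊤) ∧
    ((F.quotient P).fiberColength A (J.map (Ideal.Quotient.mk P))
          (𝔞.map (Ideal.Quotient.mk P)) = F.fiberColength A J 𝔞 ↔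
      ∀ n, n ≤ F.reductionNumber 𝔞 →
        F.ideal n ⊓ P ≤ 𝔞 * F.prevIdeal n ⊔ J * F.ideal n) := by
  have h1 := h𝔞.le_ideal_one
  have hadd {Q P : Ideal A} (h : Q ≤ P) := Submodule.relLength_add
    (K := (F.colengthIdeal J 𝔞 Q).restrictScalars A)
    (N := (F.colengthIdeal J 𝔞 P).restrictScalars A) (colengthIdeal_mono J 𝔞 h) le_top
  rw [IdealFiltration.fiberColength_quotient J P h1, IdealFiltration.fiberColength_quotient J Q h1,
    fiberColength_eq A J h1]
  have hfin : Submodule.relLength ((F.colengthIdeal J 𝔞 ⊥).restrictScalars A) ⊤ ≠ ⊤ := by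
    obtain ⟨N, hN⟩ := h𝔞.fiberTail_le_colengthIdeal J
    have h2 := length_quotient_fiberTail F J N
    rw [sum_hilbert_eq_coe hc, ← (Submodule.Quotient.restrictScalarsEquiv A
      (F.fiberTail J N)).length_eq, ← Submodule.relLength_top, Submodule.relLength_add
      (N := (F.colengthIdeal J 𝔞 ⊥).restrictScalars A) hN le_top] at h2
    -- The ideal contains a tail of the Rees algebra, whose colength is a finite sum of finite
    -- Hilbert values.
    exact ne_top_of_le_ne_top (h2 ▸ ENat.natCast_ne_top _) le_add_self
  refine ⟨⟨(hadd hQP).symm ▸ le_add_self, (hadd bot_le).symm ▸ le_add_self, hfin⟩, ?_⟩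
  have hiff : (∀ n, n ≤ F.reductionNumber 𝔞 →
        F.ideal n ⊓ P ≤ 𝔞 * F.prevIdeal n ⊔ J * F.ideal n) ↔
      F.colengthIdeal J 𝔞 P ≤ F.colengthIdeal J 𝔞 ⊥ := by
    rw [colengthIdeal_le_iff h1]
    refine ⟨fun h n => ?_, fun h n _ => h n⟩
    by_cases hn : n ≤ F.reductionNumber 𝔞
    · exact h n hn
    · exact inf_le_left.trans
        ((h𝔞.ideal_le_of_reductionNumber_lt (not_le.1 hn)).trans le_sup_left)
  rw [hiff]
  have h3 := hadd (bot_le : (⊥ : Ideal A) ≤ P)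
  have h4 : F.colengthIdeal J 𝔞 P ≤ F.colengthIdeal J 𝔞 ⊥ ↔
      Submodule.relLength ((F.colengthIdeal J 𝔞 ⊥).restrictScalars A)
        ((F.colengthIdeal J 𝔞 P).restrictScalars A) = 0 :=
    (Submodule.relLength_eq_zero_iff (N := (F.colengthIdeal J 𝔞 ⊥).restrictScalars A)
      (M := (F.colengthIdeal J 𝔞 P).restrictScalars A)).symm
  rw [h4]
  constructor
  · intro h5
    -- Finiteness of the colength allows it to be cancelled in `ℕ∞`.
    rw [← h5] at h3 hfin
    exact (WithTop.add_right_inj hfin).1 (h3.symm.trans (zero_add _).symm)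
  · intro h5
    rw [h3, h5, zero_add]

end IdealFiltration

theorem proposition3p1 {A : Type u} [CommRing A] [IsLocalRing A] [IsNoetherianRing A]
    [Infinite (IsLocalRing.ResidueField A)]
    (J : Ideal A) (hJ : J.radical = IsLocalRing.maximalIdeal A)
    (F : IdealFiltration A) (hF : F.IsGood)
    (l : ℕ) (hl : F.analyticSpread = l) (hl_pos : 0 < l)
    (x : Fin l → A) (hx : F.IsWeakFCSequence J x)
    (𝔞 : Ideal A) (h𝔞 : 𝔞 = Ideal.span (Set.range x))
    (i : ℕ) (hi : i < l)
    (Q : Ideal A) (hQ : Q = initialIdeal x i)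
    (P : Ideal A) (hP : P = idealSaturation Q (F.ideal 1)) :
    -- the three multiplicities exist and are equal
    (∃ e : ℝ, F.HasFiberMultiplicity J e ∧
      (F.quotient Q).HasFiberMultiplicity (J.map (Ideal.Quotient.mk Q)) e ∧
      (F.quotient P).HasFiberMultiplicity (J.map (Ideal.Quotient.mk P)) e) ∧
    -- the three colengths are finite and decrease
    ((F.quotient P).fiberColength A (J.map (Ideal.Quotient.mk P)) (𝔞.map (Ideal.Quotient.mk P)) ≤
        (F.quotient Q).fiberColength A (J.map (Ideal.Quotient.mk Q))
          (𝔞.map (Ideal.Quotient.mk Q)) ∧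
      (F.quotient Q).fiberColength A (J.map (Ideal.Quotient.mk Q))
          (𝔞.map (Ideal.Quotient.mk Q)) ≤
        F.fiberColength A J 𝔞 ∧
      F.fiberColength A J 𝔞 ≠ ⊤) ∧
    -- `𝔞` is a reduction, so that the reduction number is defined, and the criterion for equality
    F.IsReduction 𝔞 ∧
    ((F.quotient P).fiberColength A (J.map (Ideal.Quotient.mk P))
          (𝔞.map (Ideal.Quotient.mk P)) = F.fiberColength A J 𝔞 ↔
      ∀ n, n ≤ F.reductionNumber 𝔞 →
        F.ideal n ⊓ P ≤ 𝔞 * F.prevIdeal n ⊔ J * F.ideal n) := by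
  have hJm : J ≤ IsLocalRing.maximalIdeal A := hJ ▸ Ideal.le_radical
  obtain ⟨c, hc⟩ : ∃ c, IsLocalRing.maximalIdeal A ^ c ≤ J := by
    obtain ⟨c, hc⟩ := J.exists_radical_pow_le_of_fg (IsNoetherian.noetherian _)
    exact ⟨c, hJ ▸ hc⟩
  obtain ⟨-, 𝔟, h𝔟⟩ := hF
  rw [← initialIdeal_eq_span_range] at h𝔞
  have hred : F.IsReduction 𝔞 := h𝔞 ▸ hx.isReduction h𝔟 hJm hc hl.le
  have hQP : Q ≤ P := hP ▸ le_idealSaturation Q _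
  obtain ⟨h2, h3⟩ := hred.fiberColength_quotient hc hQP
  refine ⟨?_, h2, hred, h3⟩
  obtain ⟨e, he, hlim⟩ := hx.exists_tendsto_sequenceHilbert h𝔟 hJm hc hl.le hl_pos
  subst h𝔞 hQ
  obtain ⟨N, hN⟩ := h𝔟.exists_sup_inf_idealSaturation_le (initialIdeal x i)
  refine ⟨e, IdealFiltration.hasFiberMultiplicity_of_tendsto_sequenceHilbert hred hJm hc he (j := l - 1) (by omega)
    (hlim 0 (l - 1) (by omega)), ?_, ?_⟩
  · exact hx.hasFiberMultiplicity_quotient hred hJm hc he (j := l - i - 1) (by omega)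
      (hlim i _ (by omega)) le_rfl (Eventually.of_forall fun _ => rfl)
  · refine hx.hasFiberMultiplicity_quotient hred hJm hc he (j := l - i - 1) (by omega)
      (hlim i _ (by omega)) hQP ?_
    filter_upwards [eventually_ge_atTop N] with n hn
    exact IdealFiltration.hilbertMod_eq_of_inf_le hQP (hP ▸ hN n hn)
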